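/- Let $\Delta_A,\Delta_B\ge 1$ be integers and let $\gamma_A,\gamma_B>0$ and $\delta_A,\delta_B<1/6$ be real numbers. Then there are constants $B,\beta>0$, depending only on these six parameters, such that the following holds. Let $G$ be a finite bipartite graph with vertex parts $V_A,V_B$, in which every vertex of $V_A$ has degree $\Delta_A$ and every vertex of $V_B$ has degree $\Delta_B$. For a set $S$ of vertices let $\Gamma(S)$ be the set of vertices adjacent to at least one vertex of $S$. Suppose that $|\Gamma(S)|\ge(1-\delta_A)\Delta_A|S|$ for every $S\subseteq V_A$ with $|S|\le\gamma_A|V_A|$, and $|\Gamma(S)|\ge(1-\delta_B)\Delta_B|S|$ for every $S\subseteq V_B$ with $|S|\le\gamma_B|V_B|$. Let $H\in\mathbb{F}_2^{V_B\times V_A}$ be the biadjacency matrix of $G$. The quantum expander code (of Leverrier, Tillich and Zémor) of $G$ is the CSS code on the $n=|V_A|^2+|V_B|^2$ qubits $V_A^2\sqcup V_B^2$ with parity-check matrices $H_X=(I\otimes H\mid H^{T}\otimes I)$ and $H_Z=(H\otimes I\mid I\otimes H^{T})$. Then the Union-Find decoder corrects every $X$ error and every $Z$ error of weight at most $Bn^\beta$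 of this code. Here an $X$ error is a set $x$ of qubits, its weight is $|x|$, and its syndrome $\sigma$ is the set of rows of $H_Z$ whose support meets $x$ in an odd number of qubits. The Union-Find decoder works in the Tanner graph $T$ of $H_Z$, whose vertices are the qubits and the rows of $H_Z$, each row being joined to the qubits in its support. A vertex set $\mathcal{E}$ of $T$ is valid if there is a set $\tilde x$ of qubits of $\mathcal{E}$, all of whose neighbours in $T$ lie in $\mathcal{E}$, with syndrome $\sigma\cap\mathcal{E}$; such an $\tilde x$ is called a valid correction in $\mathcal{E}$. The decoder starts from $\mathcal{E}=\sigma$; while some connected component of $\mathcal{E}$ (in the subgraph of $T$ induced by $\mathcal{E}$) is not valid, it adds to $\mathcal{E}$ all neighbours of $\mathcal{E}$; after that it chooses an arbitrary valid correction in every connected component of $\mathcal{E}$ and returns their union $\tilde x$. It corrects $x$ if it halts with an output and, for every output $\tilde x$ that it can return, the sum modulo 2 of the indicator vectors of $x$ and $\tilde x$ lies in the row space of $H_X$. For $Z$ errors, exchange the roles of $H_X$ and $H_Z$. -/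

import Mathlib

namespace QExp

/-! ### Vertex sets of graphs -/

section Graphs

variable {V : Type*}

/-- The ball of radius `r` around a vertex set `S` (unreachable vertices are at distance `⊤`). -/
def ball (T : SimpleGraph V) (S : Set V) (r : ℕ) : Set V :=
  {v | ∃ u ∈ S, T.edist u v ≤ (r : ℕ∞)}

/-- The interior of `S`: the vertices of `S` all of whose neighbours are in `S`. -/
def interior (T : SimpleGraph V) (S : Set V) : Set V :=
  {u | u ∈ S ∧ ball T {u} 1 ⊆ S}

/-- The connected components of a vertex set `S`: classes of mutual reachability by paths
inside `S`. -/
def components (T : SimpleGraph V) (S : Set V) : Set (Set V) :=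
  Set.range fun c : (T.induce S).ConnectedComponent => Subtype.val '' c.supp

end Graphs

/-! ### CSS codes -/

/-- A CSS code with qubits indexed by `Q`, `X` generators by `RX`, `Z` generators by `RZ`. -/
structure CSSCode (Q RX RZ : Type*) [Fintype Q] where
  HX : Matrix RX Q (ZMod 2)
  HZ : Matrix RZ Q (ZMod 2)
  orthogonal : HX * HZ.transpose = 0

/-- The code with the roles of `X` and `Z` exchanged. -/
def CSSCode.swap {Q RX RZ : Type*} [Fintype Q] (C : CSSCode Q RX RZ) : CSSCode Q RZ RX where
  HX := C.HZ
  HZ := C.HX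
  orthogonal := by
    have h := congrArg Matrix.transpose C.orthogonal
    simpa [Matrix.transpose_mul] using h

section Decoder

variable {Q R : Type*}

/-- The binary vector of a set of qubits. -/
noncomputable def errorVector (x : Finset Q) : Q → ZMod 2 :=
  Set.indicator (x : Set Q) 1

/-- The syndrome of the error `x` for the parity-check matrix `H`: the checks incident to an odd
number of qubits of `x`. -/
def syndrome (H : Matrix R Q (ZMod 2)) (x : Finset Q) : Set R :=
  {c | Odd (x.filter fun q => H c q ≠ 0).card}

/-- The Tanner graph of a parity-check matrix; the vertices are the qubits (`Sum.inl`) and the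
checks (`Sum.inr`). -/
def tannerGraph (H : Matrix R Q (ZMod 2)) : SimpleGraph (Q ⊕ R) :=
  SimpleGraph.fromRel fun u v => ∃ q c, u = Sum.inl q ∧ v = Sum.inr c ∧ H c q ≠ 0

/-- `y` is a valid correction in the vertex set `E` for the syndrome `σ`. -/
def IsValidCorrection (H : Matrix R Q (ZMod 2)) (σ : Set R) (E : Set (Q ⊕ R))
    (y : Finset Q) : Prop :=
  (∀ q ∈ y, Sum.inl q ∈ interior (tannerGraph H) E) ∧
    (Sum.inr '' syndrome H y : Set (Q ⊕ R)) = Sum.inr '' σ ∩ E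

/-- The vertex set `E` is valid for the syndrome `σ`. -/
def IsValid (H : Matrix R Q (ZMod 2)) (σ : Set R) (E : Set (Q ⊕ R)) : Prop :=
  ∃ y : Finset Q, IsValidCorrection H σ E y

/-- The vertex set after `k` growth rounds, starting from the syndrome. -/
def grown (H : Matrix R Q (ZMod 2)) (σ : Set R) : ℕ → Set (Q ⊕ R)
  | 0 => Sum.inr '' σ
  | k + 1 => ball (tannerGraph H) (grown H σ k) 1

/-- The exit condition of the growth loop: no connected component is invalid. -/
def AllComponentsValid (H : Matrix R Q (ZMod 2)) (σ : Set R) (E : Set (Q ⊕ R)) : Prop :=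
  ∀ K ∈ components (tannerGraph H) E, IsValid H σ K

/-- `y` is a possible output of the Union-Find decoder on the syndrome `σ`: growth stops at the
first round `k` at which no component is invalid, an arbitrary valid correction `f K` is chosen
in every connected component `K`, and `y` is the union of these. -/
def IsUnionFindOutput (H : Matrix R Q (ZMod 2)) (σ : Set R) (y : Finset Q) : Prop :=
  ∃ k : ℕ, AllComponentsValid H σ (grown H σ k) ∧
    (∀ j < k, ¬ AllComponentsValid H σ (grown H σ j)) ∧
    ∃ f : Set (Q ⊕ R) → Finset Q,
      (∀ K ∈ components (tannerGraph H) (grown H σ k), IsValidCorrection H σ K (f K)) ∧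
      ∀ q, q ∈ y ↔ ∃ K ∈ components (tannerGraph H) (grown H σ k), q ∈ f K

end Decoder

section Correction

variable {Q RX RZ : Type*} [Fintype Q]

/-- The Union-Find decoder corrects the `X` error `x`: the decoder halts with an output, and for
every output it can return, the residual error is a stabilizer, i.e. lies in the row space
of `HX`. -/
def CSSCode.UnionFindCorrectsX (C : CSSCode Q RX RZ) (x : Finset Q) : Prop :=
  (∃ y, IsUnionFindOutput C.HZ (syndrome C.HZ x) y) ∧
    ∀ y, IsUnionFindOutput C.HZ (syndrome C.HZ x) y →
      errorVector x + errorVector y ∈ Submodule.span (ZMod 2) (Set.range C.HX.row)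

/-- The Union-Find decoder corrects the `Z` error `x`. -/
def CSSCode.UnionFindCorrectsZ (C : CSSCode Q RX RZ) (x : Finset Q) : Prop :=
  C.swap.UnionFindCorrectsX x

end Correction

/-! ### Quantum expander codes -/

section Expander

open scoped Kronecker

variable {A B : Type*} [Fintype A] [Fintype B]

open Classical in
/-- The bipartite graph with edge relation `G` has all left degrees `ΔA`, all right degrees `ΔB`. -/
def IsBiregular (G : A → B → Prop) (ΔA ΔB : ℕ) : Prop :=
  (∀ a, (Finset.univ.filter fun b => G a b).card = ΔA) ∧
    ∀ b, (Finset.univ.filter fun a => G a b).card = ΔB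

open Classical in
/-- Every set `S` of at most `γ |A|` left vertices has at least `(1 - δ) Δ |S|` neighbours. -/
def IsLeftExpanding (G : A → B → Prop) (Δ : ℕ) (γ δ : ℝ) : Prop :=
  ∀ S : Finset A, (S.card : ℝ) ≤ γ * Fintype.card A →
    (1 - δ) * Δ * S.card ≤ ((Finset.univ.filter fun b => ∃ a ∈ S, G a b).card : ℝ)

/-- Every set of at most `γ |B|` right vertices has at least `(1 - δ) Δ |S|` neighbours. -/
def IsRightExpanding (G : A → B → Prop) (Δ : ℕ) (γ δ : ℝ) : Prop :=
  IsLeftExpanding (fun b a => G a b) Δ γ δ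

open Classical in
/-- The parity-check matrix of the classical code with Tanner graph `G`, bits `A`, checks `B`. -/
noncomputable def parityCheck (G : A → B → Prop) : Matrix B A (ZMod 2) :=
  Matrix.of fun b a => if G a b then 1 else 0

open Classical in
/-- The `X` generator matrix `(1 ⊗ H | Hᵀ ⊗ 1)` of the hypergraph product: the generator `(a, b)`
acts on the qubits `(a, a')` with `a'` adjacent to `b`, and `(b', b)` with `b'` adjacent
to `a`. -/
noncomputable def productHX (G : A → B → Prop) : Matrix (A × B) ((A × A) ⊕ (B × B)) (ZMod 2) :=
  Matrix.fromCols ((1 : Matrix A A (ZMod 2)) ⊗ₖ parityCheck G)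
    ((parityCheck G).transpose ⊗ₖ (1 : Matrix B B (ZMod 2)))

open Classical in
/-- The `Z` generator matrix `(H ⊗ 1 | 1 ⊗ Hᵀ)` of the hypergraph product: the generator `(b, a)`
acts on the qubits `(a', a)` with `a'` adjacent to `b`, and `(b, b')` with `b'` adjacent
to `a`. -/
noncomputable def productHZ (G : A → B → Prop) : Matrix (B × A) ((A × A) ⊕ (B × B)) (ZMod 2) :=
  Matrix.fromCols (parityCheck G ⊗ₖ (1 : Matrix A A (ZMod 2)))
    ((1 : Matrix B B (ZMod 2)) ⊗ₖ (parityCheck G).transpose)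

/-- The hypergraph product code of the bipartite graph `G` with itself. -/
noncomputable def productCode (G : A → B → Prop) :
    CSSCode ((A × A) ⊕ (B × B)) (A × B) (B × A) where
  HX := productHX G
  HZ := productHZ G
  orthogonal := by
    classical
    have two (M : Matrix (A × B) (B × A) (ZMod 2)) : M + M = 0 := by
      ext i j
      exact CharTwo.add_self_eq_zero (M i j)
    simp only [productHX, productHZ, Matrix.transpose_fromCols, Matrix.fromCols_mul_fromRows,
      ← Matrix.kroneckerMap_transpose, ← Matrix.mul_kronecker_mul, Matrix.transpose_one,
      Matrix.transpose_transpose, Matrix.one_mul, Matrix.mul_one]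
    exact two _

end Expander

end QExp

namespace QExp

open scoped symmDiff

/-! ### Errors and syndromes -/

section Syndrome

variable {Q R : Type*}

/-! Call an error reduced if it has minimal weight in its class modulo stabilizers, and put D = ΔA +
ΔB, which bounds all degrees of the Tanner graph. Expansion is used only to obtain soundness: |x| ≤
D |σ(x)| for every reduced x of weight up to a constant times √n. The analysis of the decoder needs
only soundness and bounded degree.

Soundness. As δ < 1/6, a small vertex set always has a member more than two thirds of whose
neighbours are shared with no other member (`exists_many_unique_neighbors`). Using this on both
sides of G, one finds, outside two easy cases, a generator (a, b) and large sets U, U' of neighbours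
of a and b such that the checks in U × U' meet the error only inside that generator. A reduced error
fills at most half of a generator, and then flipping either its part in U, U' or the complement of
that part lowers the syndrome weight (`exists_flip`). Iterating such flips bounds the weight by the
syndrome (`IsFlippable.card_le`).

Decoding. The part N of a reduced error not yet reached by growth is itself reduced, so it violates
at least |N|/D checks. Each of these also meets a reached qubit, so its qubits in N are reached two
rounds later. Hence |N| shrinks by the factor 1 - 1/D² every two rounds
(`IsSound.card_uncovered_le`), and O(log |x|) rounds cover the error. By then the grown set has size
polynomial in |x|. An output lies in it and has the right syndrome, so the residual error has zero
syndrome and small weight; soundness makes it a stabilizer. Since |V_A| and |V_B| are of order √n, a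
weight bound of order n^β suffices. -/

theorem errorVector_apply [DecidableEq Q] (x : Finset Q) (q : Q) :
    errorVector x q = if q ∈ x then 1 else 0 := by
  simp [errorVector, Set.indicator_apply]

theorem errorVector_symmDiff [DecidableEq Q] (x y : Finset Q) :
    errorVector (x ∆ y) = errorVector x + errorVector y := by
  ext q
  simp only [errorVector_apply, Pi.add_apply, Finset.mem_symmDiff]
  by_cases hx : q ∈ x <;> by_cases hy : q ∈ y <;> simp [hx, hy]
  exact (CharTwo.add_self_eq_zero (1 : ZMod 2)).symm

theorem add_self_eq_zero_of_zmod_two (v : Q → ZMod 2) : v + v = 0 := by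
  ext q
  exact CharTwo.add_self_eq_zero (v q)

theorem mem_syndrome_iff [Fintype Q] (H : Matrix R Q (ZMod 2)) (x : Finset Q) (c : R) :
    c ∈ syndrome H x ↔ H.mulVec (errorVector x) c ≠ 0 := by
  classical
  have h : H.mulVec (errorVector x) c = ((x.filter fun q => H c q ≠ 0).card : ZMod 2) := by
    have h01 : ∀ z : ZMod 2, z = if z ≠ 0 then 1 else 0 := by decide
    rw [Finset.card_filter, Nat.cast_sum, Matrix.mulVec, dotProduct]
    simp only [errorVector_apply, mul_ite, mul_one, mul_zero, Finset.sum_ite_mem,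
      Finset.univ_inter]
    refine Finset.sum_congr rfl fun q _ => ?_
    rw [Nat.cast_ite, Nat.cast_one, Nat.cast_zero]
    exact h01 (H c q)
  rw [h, ZMod.natCast_ne_zero_iff_odd]
  exact Iff.rfl

theorem syndrome_symmDiff [Fintype Q] [DecidableEq Q] (H : Matrix R Q (ZMod 2))
    (x y : Finset Q) : syndrome H (x ∆ y) = syndrome H x ∆ syndrome H y := by
  ext c
  have h : ∀ a b : ZMod 2, a + b ≠ 0 ↔ (a ≠ 0 ∧ ¬ b ≠ 0) ∨ (b ≠ 0 ∧ ¬ a ≠ 0) := by decide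
  rw [Set.mem_symmDiff, mem_syndrome_iff, mem_syndrome_iff, mem_syndrome_iff,
    errorVector_symmDiff, Matrix.mulVec_add, Pi.add_apply]
  exact h _ _

theorem syndrome_eq_of_add_mem [Fintype Q] {H : Matrix R Q (ZMod 2)}
    {S : Submodule (ZMod 2) (Q → ZMod 2)} (hS : ∀ s ∈ S, H.mulVec s = 0) {x y : Finset Q}
    (h : errorVector x + errorVector y ∈ S) : syndrome H x = syndrome H y := by
  ext c
  have h0 := congrFun (hS _ h) c
  rw [Matrix.mulVec_add, Pi.add_apply, Pi.zero_apply] at h0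
  rw [mem_syndrome_iff, mem_syndrome_iff, CharTwo.add_eq_zero.mp h0]

theorem exists_mem_of_mem_syndrome {H : Matrix R Q (ZMod 2)} {x : Finset Q} {c : R}
    (hc : c ∈ syndrome H x) : ∃ q ∈ x, H c q ≠ 0 := by
  obtain ⟨q, hq⟩ := Finset.card_pos.mp (Odd.pos (show Odd _ from hc))
  exact ⟨q, (Finset.mem_filter.mp hq).1, (Finset.mem_filter.mp hq).2⟩

theorem mem_syndrome_congr {H : Matrix R Q (ZMod 2)} {x y : Finset Q} {c : R}
    (h : ∀ q, H c q ≠ 0 → (q ∈ x ↔ q ∈ y)) : c ∈ syndrome H x ↔ c ∈ syndrome H y := by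
  have : (x.filter fun q => H c q ≠ 0) = y.filter fun q => H c q ≠ 0 := by
    ext q
    simp only [Finset.mem_filter]
    exact and_congr_left (h q)
  simp only [syndrome, Set.mem_ofPred_eq, this]

/-- The matrix `H` has at most `D` nonzero entries in each row and in each column. -/
def IsSparse (H : Matrix R Q (ZMod 2)) (D : ℕ) : Prop :=
  (∀ c, {q | H c q ≠ 0}.encard ≤ D) ∧ ∀ q, {c | H c q ≠ 0}.encard ≤ D

theorem ncard_syndrome_le [Finite R] {H : Matrix R Q (ZMod 2)} {D : ℕ} (hD : IsSparse H D)
    (x : Finset Q) : (syndrome H x).ncard ≤ D * x.card := by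
  classical
  have hfin : ∀ q, ({c | H c q ≠ 0}).Finite := fun q => Set.toFinite _
  have hsub : syndrome H x ⊆ (x.biUnion fun q => (hfin q).toFinset : Finset R) := by
    intro c hc
    obtain ⟨q, hq, hcq⟩ := exists_mem_of_mem_syndrome hc
    simpa using ⟨q, hq, hcq⟩
  refine (Set.ncard_le_ncard hsub (Finset.finite_toSet _)).trans ?_
  rw [Set.ncard_coe_finset, mul_comm]
  refine Finset.card_biUnion_le_card_mul _ _ _ fun q _ => ?_
  have := hD.2 q
  rw [(hfin q).encard_eq_coe_toFinset_card] at this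
  exact_mod_cast this

end Syndrome

/-! ### Reduced errors -/

section Reduced

variable {Q R : Type*}

/-- The error `x` has minimal weight modulo the space `S`. -/
def IsReduced (S : Submodule (ZMod 2) (Q → ZMod 2)) (x : Finset Q) : Prop :=
  ∀ y : Finset Q, errorVector x + errorVector y ∈ S → x.card ≤ y.card

theorem exists_isReduced (S : Submodule (ZMod 2) (Q → ZMod 2)) (x : Finset Q) :
    ∃ y, IsReduced S y ∧ errorVector x + errorVector y ∈ S ∧ y.card ≤ x.card := by
  classical
  have hx : errorVector x + errorVector x ∈ S := by
    rw [add_self_eq_zero_of_zmod_two]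
    exact S.zero_mem
  have hex : ∃ k, ∃ y : Finset Q, errorVector x + errorVector y ∈ S ∧ y.card = k := ⟨_, x, hx, rfl⟩
  obtain ⟨y, hy, hyk⟩ := Nat.find_spec hex
  refine ⟨y, fun z hz => ?_, hy, hyk ▸ Nat.find_min' hex ⟨x, hx, rfl⟩⟩
  rw [hyk]
  refine Nat.find_min' hex ⟨z, ?_, rfl⟩
  have := S.add_mem hy hz
  rwa [show errorVector x + errorVector y + (errorVector y + errorVector z)
    = errorVector x + errorVector z + (errorVector y + errorVector y) by abel,
    add_self_eq_zero_of_zmod_two, add_zero] at this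

theorem card_symmDiff_le [DecidableEq Q] (x y : Finset Q) :
    (x ∆ y).card ≤ x.card + y.card :=
  (Finset.card_le_card (by
    intro q hq
    rw [Finset.mem_symmDiff] at hq
    rw [Finset.mem_union]
    tauto)).trans (Finset.card_union_le x y)

/-- A lighter representative of the class of y could be substituted for y inside x, giving a lighter
representative of the class of x. This lets soundness be applied to the uncovered part of an error.
-/
theorem IsReduced.subset {S : Submodule (ZMod 2) (Q → ZMod 2)} {x y : Finset Q}
    (hx : IsReduced S x) (hyx : y ⊆ x) : IsReduced S y := by
  classical
  intro z hz
  have hxy : errorVector x = errorVector y + errorVector (x \ y) := by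
    rw [← errorVector_symmDiff]
    congr 1
    ext q
    have := @hyx q
    simp only [Finset.mem_symmDiff, Finset.mem_sdiff]
    tauto
  have h := hx (z ∆ (x \ y)) (by
    rwa [errorVector_symmDiff, hxy,
      show errorVector y + errorVector (x \ y) + (errorVector z + errorVector (x \ y))
        = errorVector y + errorVector z + (errorVector (x \ y) + errorVector (x \ y)) by abel,
      add_self_eq_zero_of_zmod_two, add_zero])
  have h1 := card_symmDiff_le z (x \ y)
  have h2 := Finset.card_sdiff_add_card_eq_card hyx
  omega

/-- Every nonzero reduced error of weight at most `m` has its syndrome weight lowered by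
flipping at most `D` qubits. -/
def IsFlippable [DecidableEq Q] (H : Matrix R Q (ZMod 2))
    (S : Submodule (ZMod 2) (Q → ZMod 2)) (m D : ℕ) : Prop :=
  ∀ x, IsReduced S x → x.Nonempty → x.card ≤ m →
    ∃ f : Finset Q, f.card ≤ D ∧ (syndrome H (x ∆ f)).ncard < (syndrome H x).ncard

/-- Induction on the syndrome weight. A flip followed by reduction costs at most D in weight and
lowers the syndrome weight by at least 1, so |x| + D |σ(x)| does not increase and the error never
leaves the range where flips exist. -/
theorem IsFlippable.card_le [Fintype Q] [DecidableEq Q] {H : Matrix R Q (ZMod 2)}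
    {S : Submodule (ZMod 2) (Q → ZMod 2)} {m D : ℕ} (hS : ∀ s ∈ S, H.mulVec s = 0)
    (hflip : IsFlippable H S m D) {x : Finset Q} (hx : IsReduced S x)
    (hm : x.card + D * (syndrome H x).ncard ≤ m) : x.card ≤ D * (syndrome H x).ncard := by
  induction hs : (syndrome H x).ncard using Nat.strong_induction_on generalizing x with
  | _ s ih =>
    subst hs
    obtain rfl | hne := x.eq_empty_or_nonempty
    · simp
    obtain ⟨f, hf, hlt⟩ := hflip x hx hne (by omega)
    obtain ⟨y, hy, hxy, hcard⟩ := exists_isReduced S (x ∆ f)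
    have hsyn := syndrome_eq_of_add_mem hS hxy
    have h1 := card_symmDiff_le x f
    have hmul : D * (syndrome H y).ncard + D ≤ D * (syndrome H x).ncard := by
      rw [← hsyn, ← Nat.mul_succ]
      exact Nat.mul_le_mul_left D hlt
    have h2 := ih _ (hsyn ▸ hlt) hy (by omega) rfl
    -- Since y is equivalent to x ∆ f, the error y ∆ f is equivalent to x, and minimality gives |x|
    -- ≤ |y| + D.
    have h3 := hx (y ∆ f) (by
      rw [errorVector_symmDiff] at hxy ⊢
      rwa [show errorVector x + (errorVector y + errorVector f)
        = errorVector x + errorVector f + errorVector y by abel])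
    have h4 := card_symmDiff_le y f
    omega

/-- Reduced errors of weight at most `M` are bounded by `D` times their syndrome weight. -/
def IsSound (H : Matrix R Q (ZMod 2)) (S : Submodule (ZMod 2) (Q → ZMod 2)) (M D : ℕ) : Prop :=
  ∀ x, IsReduced S x → x.card ≤ M → x.card ≤ D * (syndrome H x).ncard

theorem IsFlippable.isSound [Fintype Q] [DecidableEq Q] [Finite R] {H : Matrix R Q (ZMod 2)}
    {S : Submodule (ZMod 2) (Q → ZMod 2)} {m M D : ℕ} (hS : ∀ s ∈ S, H.mulVec s = 0)
    (hflip : IsFlippable H S m D) (hD : IsSparse H D) (hM : M * (1 + D ^ 2) ≤ m) :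
    IsSound H S M D := by
  intro x hx hxM
  refine hflip.card_le hS hx ?_
  have h := ncard_syndrome_le hD x
  calc x.card + D * (syndrome H x).ncard ≤ x.card + D * (D * x.card) := by gcongr
    _ = x.card * (1 + D ^ 2) := by ring
    _ ≤ M * (1 + D ^ 2) := by gcongr
    _ ≤ m := hM

/-- A reduced representative of x still has empty syndrome, so soundness forces it to be empty. -/
theorem IsSound.mem_of_syndrome_eq_empty [Fintype Q] {H : Matrix R Q (ZMod 2)}
    {S : Submodule (ZMod 2) (Q → ZMod 2)} {M D : ℕ} (hS : ∀ s ∈ S, H.mulVec s = 0)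
    (h : IsSound H S M D) {x : Finset Q} (hx : x.card ≤ M) (hs : syndrome H x = ∅) :
    errorVector x ∈ S := by
  obtain ⟨y, hy, hxy, hcard⟩ := exists_isReduced S x
  have h1 := h y hy (hcard.trans hx)
  rw [← syndrome_eq_of_add_mem hS hxy, hs, Set.ncard_empty, mul_zero, Nat.le_zero,
    Finset.card_eq_zero] at h1
  have h0 : errorVector (∅ : Finset Q) = 0 := by
    ext q
    simp [errorVector]
  rwa [h1, h0, add_zero] at hxy

end Reduced

/-! ### Connected components of vertex sets -/

section Components

variable {V : Type*} {T : SimpleGraph V}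

theorem mem_ball_one {S : Set V} {v : V} : v ∈ ball T S 1 ↔ v ∈ S ∨ ∃ u ∈ S, T.Adj u v := by
  simp only [ball, Set.mem_ofPred_eq, Nat.cast_one, SimpleGraph.edist_le_one_iff_adj_or_eq]
  constructor
  · rintro ⟨u, hu, h | rfl⟩
    exacts [Or.inr ⟨u, hu, h⟩, Or.inl hu]
  · rintro (h | ⟨u, hu, h⟩)
    exacts [⟨v, h, Or.inr rfl⟩, ⟨u, hu, Or.inl h⟩]

theorem mem_interior_iff {S : Set V} {u : V} :
    u ∈ interior T S ↔ u ∈ S ∧ ∀ v, T.Adj u v → v ∈ S := by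
  refine and_congr_right fun hu => ⟨fun h v hv => h (mem_ball_one.mpr (Or.inr ⟨u, rfl, hv⟩)), ?_⟩
  intro h v hv
  rcases mem_ball_one.mp hv with rfl | ⟨w, rfl, hw⟩
  exacts [hu, h v hw]

theorem subset_of_mem_components {S K : Set V} (hK : K ∈ components T S) : K ⊆ S := by
  obtain ⟨c, rfl⟩ := hK
  rintro _ ⟨u, -, rfl⟩
  exact u.2

theorem exists_mem_components {S : Set V} {u : V} (hu : u ∈ S) :
    ∃ K ∈ components T S, u ∈ K :=
  ⟨_, ⟨(T.induce S).connectedComponentMk ⟨u, hu⟩, rfl⟩, ⟨⟨u, hu⟩, rfl, rfl⟩⟩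

theorem mem_component_of_adj {S K : Set V} (hK : K ∈ components T S) {u v : V} (hu : u ∈ K)
    (hv : v ∈ S) (huv : T.Adj u v) : v ∈ K := by
  obtain ⟨c, rfl⟩ := hK
  obtain ⟨w, hw, rfl⟩ := hu
  refine ⟨⟨v, hv⟩, ?_, rfl⟩
  have hadj : (T.induce S).Adj w ⟨v, hv⟩ := huv
  rw [SimpleGraph.ConnectedComponent.mem_supp_iff] at hw ⊢
  rw [← hw]
  exact SimpleGraph.ConnectedComponent.sound hadj.symm.reachable

theorem eq_of_mem_components {S K L : Set V} (hK : K ∈ components T S)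
    (hL : L ∈ components T S) {u : V} (huK : u ∈ K) (huL : u ∈ L) : K = L := by
  obtain ⟨c, rfl⟩ := hK
  obtain ⟨d, rfl⟩ := hL
  obtain ⟨w, hw, rfl⟩ := huK
  obtain ⟨w', hw', h⟩ := huL
  obtain rfl := Subtype.ext h
  rw [SimpleGraph.ConnectedComponent.mem_supp_iff] at hw hw'
  rw [← hw, ← hw']

theorem ncard_ball_one_le [Finite V] {D : ℕ} (hD : ∀ v, {u | T.Adj v u}.encard ≤ D)
    (S : Set V) : (ball T S 1).ncard ≤ (D + 1) * S.ncard := by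
  classical
  have := Fintype.ofFinite V
  have hsub : ball T S 1 ⊆
      (S.toFinset.biUnion fun u => insert u {v | T.Adj u v}.toFinset : Finset V) := by
    intro v hv
    simp only [Finset.coe_biUnion, Set.mem_iUnion]
    rcases mem_ball_one.mp hv with h | ⟨u, hu, h⟩
    · exact ⟨v, by simpa using h, by simp⟩
    · exact ⟨u, by simpa using hu, by simp [h]⟩
  refine (Set.ncard_le_ncard hsub (Finset.finite_toSet _)).trans ?_
  rw [Set.ncard_coe_finset, mul_comm, Set.ncard_eq_toFinset_card']
  refine Finset.card_biUnion_le_card_mul _ _ _ fun u _ => (Finset.card_insert_le _ _).trans ?_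
  have := hD u
  rw [Set.encard_eq_coe_toFinset_card] at this
  exact Nat.succ_le_succ (by exact_mod_cast this)

end Components

/-! ### The Union-Find decoder -/

section UnionFind

variable {Q R : Type*} {H : Matrix R Q (ZMod 2)}

@[simp]
theorem tannerGraph_adj_inl_inr {q : Q} {c : R} :
    (tannerGraph H).Adj (Sum.inl q) (Sum.inr c) ↔ H c q ≠ 0 := by
  simp [tannerGraph]

@[simp]
theorem tannerGraph_adj_inr_inl {q : Q} {c : R} :
    (tannerGraph H).Adj (Sum.inr c) (Sum.inl q) ↔ H c q ≠ 0 := by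
  rw [SimpleGraph.adj_comm, tannerGraph_adj_inl_inr]

@[simp]
theorem not_tannerGraph_adj_inl_inl {q q' : Q} :
    ¬ (tannerGraph H).Adj (Sum.inl q) (Sum.inl q') := by
  simp [tannerGraph]

@[simp]
theorem not_tannerGraph_adj_inr_inr {c c' : R} :
    ¬ (tannerGraph H).Adj (Sum.inr c) (Sum.inr c') := by
  simp [tannerGraph]

theorem IsSparse.encard_adj_le {D : ℕ} (hD : IsSparse H D) (v : Q ⊕ R) :
    {u | (tannerGraph H).Adj v u}.encard ≤ D := by
  rcases v with q | c
  · have : {u | (tannerGraph H).Adj (Sum.inl q) u} = Sum.inr '' {c | H c q ≠ 0} := by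
      ext (q' | c) <;> simp
    rw [this, Sum.inr_injective.encard_image]
    exact hD.2 q
  · have : {u | (tannerGraph H).Adj (Sum.inr c) u} = Sum.inl '' {q | H c q ≠ 0} := by
      ext (q' | c) <;> simp
    rw [this, Sum.inl_injective.encard_image]
    exact hD.1 c

theorem grown_subset_succ (σ : Set R) (k : ℕ) : grown H σ k ⊆ grown H σ (k + 1) :=
  fun _ hv => mem_ball_one.mpr (Or.inl hv)

theorem grown_mono (σ : Set R) : Monotone (grown H σ) :=
  monotone_nat_of_le_succ (grown_subset_succ σ)

theorem mem_grown_succ_of_adj {σ : Set R} {k : ℕ} {u v : Q ⊕ R} (hu : u ∈ grown H σ k)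
    (huv : (tannerGraph H).Adj u v) : v ∈ grown H σ (k + 1) :=
  mem_ball_one.mpr (Or.inr ⟨u, hu, huv⟩)

theorem ncard_grown_le [Finite Q] [Finite R] {D : ℕ} (hD : IsSparse H D) (σ : Set R) (k : ℕ) :
    (grown H σ k).ncard ≤ (D + 1) ^ k * σ.ncard := by
  induction k with
  | zero =>
    rw [pow_zero, one_mul]
    exact Set.ncard_image_le (Set.toFinite σ)
  | succ k ih =>
    calc (grown H σ (k + 1)).ncard ≤ (D + 1) * (grown H σ k).ncard :=
          ncard_ball_one_le hD.encard_adj_le _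
      _ ≤ (D + 1) * ((D + 1) ^ k * σ.ncard) := by gcongr
      _ = (D + 1) ^ (k + 1) * σ.ncard := by ring

/-- Once the interior covers an error with the given syndrome, no component is invalid. -/
theorem allComponentsValid_of_subset_interior {x : Finset Q} {E : Set (Q ⊕ R)}
    (hx : ∀ q ∈ x, Sum.inl q ∈ interior (tannerGraph H) E) :
    AllComponentsValid H (syndrome H x) E := by
  classical
  intro K hK
  -- Because the interior covers x, an error qubit and any check it meets lie in the same component.
  -- The restriction of x to K then has exactly the syndrome of x inside K.
  have hnb : ∀ q ∈ x, ∀ c, H c q ≠ 0 → (Sum.inl q ∈ K ↔ Sum.inr c ∈ K) := by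
    intro q hq c hc
    obtain ⟨h1, h2⟩ := mem_interior_iff.mp (hx q hq)
    exact ⟨fun h => mem_component_of_adj hK h (h2 _ (by simpa)) (by simpa),
      fun h => mem_component_of_adj hK h h1 (by simpa)⟩
  refine ⟨x.filter fun q => Sum.inl q ∈ K, fun q hq => ?_, ?_⟩
  · obtain ⟨hqx, hqK⟩ := Finset.mem_filter.mp hq
    refine mem_interior_iff.mpr ⟨hqK, ?_⟩
    rintro (q' | c) h
    · simp at h
    · exact (hnb q hqx c (by simpa using h)).mp hqK
  · ext (q | c)
    · simp
    · simp only [Set.mem_inter_iff, Sum.inr_injective.mem_set_image]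
      constructor
      · intro hc
        obtain ⟨q, hq, hcq⟩ := exists_mem_of_mem_syndrome hc
        obtain ⟨hqx, hqK⟩ := Finset.mem_filter.mp hq
        have hcK := (hnb q hqx c hcq).mp hqK
        refine ⟨(mem_syndrome_congr fun q' hq' => ?_).mp hc, hcK⟩
        rw [Finset.mem_filter]
        exact ⟨And.left, fun h => ⟨h, (hnb q' h c hq').mpr hcK⟩⟩
      · rintro ⟨hc, hcK⟩
        refine (mem_syndrome_congr fun q' hq' => ?_).mpr hc
        rw [Finset.mem_filter]
        exact ⟨And.left, fun h => ⟨h, (hnb q' h c hq').mpr hcK⟩⟩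

theorem exists_isUnionFindOutput [Finite Q] {σ : Set R} {k : ℕ}
    (hk : AllComponentsValid H σ (grown H σ k)) : ∃ y, IsUnionFindOutput H σ y := by
  classical
  have := Fintype.ofFinite Q
  have hex : ∃ k, AllComponentsValid H σ (grown H σ k) := ⟨k, hk⟩
  have hval := Nat.find_spec hex
  choose! f hf using hval
  refine ⟨Finset.univ.filter fun q =>
    ∃ K ∈ components (tannerGraph H) (grown H σ (Nat.find hex)), q ∈ f K, Nat.find hex,
    Nat.find_spec hex, fun j hj => Nat.find_min hex hj, f, hf, fun q => by simp⟩

/-- Corrections lie in the interior of their component, so a check sees only the correction of its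
own component, and a check outside the grown set sees none. -/
theorem IsUnionFindOutput.syndrome_eq {σ : Set R} {y : Finset Q}
    (hy : IsUnionFindOutput H σ y) : syndrome H y = σ := by
  obtain ⟨k, -, -, f, hf, hmem⟩ := hy
  have hint : ∀ K ∈ components (tannerGraph H) (grown H σ k), ∀ q ∈ f K, ∀ c, H c q ≠ 0 →
      Sum.inr c ∈ K := fun K hK q hq c hc =>
    (mem_interior_iff.mp ((hf K hK).1 q hq)).2 _ (by simpa)
  ext c
  by_cases hc : Sum.inr c ∈ grown H σ k
  · obtain ⟨K, hK, hcK⟩ := exists_mem_components (T := tannerGraph H) hc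
    have h1 : c ∈ syndrome H y ↔ c ∈ syndrome H (f K) := by
      refine mem_syndrome_congr fun q hq => ?_
      rw [hmem]
      refine ⟨?_, fun h => ⟨K, hK, h⟩⟩
      rintro ⟨L, hL, hqL⟩
      rwa [eq_of_mem_components hK hL hcK (hint L hL q hqL c hq)]
    have h2 := Set.ext_iff.mp (hf K hK).2 (Sum.inr c)
    rw [Set.mem_inter_iff, Sum.inr_injective.mem_set_image, Sum.inr_injective.mem_set_image] at h2
    rw [h1, h2]
    exact ⟨And.left, fun h => ⟨h, hcK⟩⟩
  · refine iff_of_false (fun h => ?_) fun h => hc (grown_mono σ (Nat.zero_le k) ⟨c, h, rfl⟩)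
    obtain ⟨q, hq, hcq⟩ := exists_mem_of_mem_syndrome h
    obtain ⟨K, hK, hqK⟩ := (hmem q).mp hq
    exact hc (subset_of_mem_components hK (hint K hK q hqK c hcq))

/-- Growth stops no later than any round whose components are all valid, so such a k bounds the
extent of every output. -/
theorem IsUnionFindOutput.mem_grown {σ : Set R} {y : Finset Q} (hy : IsUnionFindOutput H σ y)
    {k : ℕ} (hk : AllComponentsValid H σ (grown H σ k)) {q : Q} (hq : q ∈ y) :
    Sum.inl q ∈ grown H σ k := by
  obtain ⟨j, -, hmin, f, hf, hmem⟩ := hy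
  obtain ⟨K, hK, hqK⟩ := (hmem q).mp hq
  refine grown_mono σ (not_lt.mp fun h => hmin k h hk) (subset_of_mem_components hK ?_)
  exact (mem_interior_iff.mp ((hf K hK).1 q hqK)).1

end UnionFind

/-! ### Covering reduced errors by balls around the syndrome -/

section Covering

variable {Q R : Type*} {H : Matrix R Q (ZMod 2)}

open Classical in
/-- The qubits of `x` not reached by `k` growth rounds from the syndrome of `x`. -/
noncomputable def uncovered (H : Matrix R Q (ZMod 2)) (x : Finset Q) (k : ℕ) : Finset Q :=
  x.filter fun q => Sum.inl q ∉ grown H (syndrome H x) k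

theorem uncovered_subset (x : Finset Q) (k : ℕ) : uncovered H x k ⊆ x := by
  classical
  exact Finset.filter_subset _ _

theorem mem_uncovered {x : Finset Q} {k : ℕ} {q : Q} :
    q ∈ uncovered H x k ↔ q ∈ x ∧ Sum.inl q ∉ grown H (syndrome H x) k := by
  classical
  exact Finset.mem_filter

theorem uncovered_anti (x : Finset Q) : Antitone (uncovered H x) := by
  intro j k hjk q hq
  rw [mem_uncovered] at hq ⊢
  exact ⟨hq.1, fun h => hq.2 (grown_mono _ hjk h)⟩

/-- Every check violated by the uncovered part meets a qubit that becomes covered within the next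
two rounds, and each such qubit meets at most D checks. -/
theorem ncard_syndrome_uncovered_le [Finite R] {D : ℕ} (hD : IsSparse H D) (x : Finset Q)
    (k : ℕ) (hk : 1 ≤ k) :
    (syndrome H (uncovered H x k)).ncard + D * (uncovered H x (k + 2)).card
      ≤ D * (uncovered H x k).card := by
  classical
  set N := uncovered H x k
  have hsub : uncovered H x (k + 2) ⊆ N := uncovered_anti x (by omega)
  have hsyn : syndrome H N ⊆
      ((N \ uncovered H x (k + 2)).biUnion fun q => {c | H c q ≠ 0}.toFinite.toFinset :
        Finset R) := by
    intro c hc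
    obtain ⟨q, hqN, hcq⟩ := exists_mem_of_mem_syndrome hc
    have hq := mem_uncovered.mp hqN
    -- This is where 1 ≤ k enters: all qubits adjacent to the syndrome are covered after one round.
    have hcx : c ∉ syndrome H x := fun h => hq.2 (grown_mono _ hk
      (mem_grown_succ_of_adj (k := 0) (u := Sum.inr c) ⟨c, h, rfl⟩ (by simpa)))
    -- The check c is violated by N but not by x, so x and N differ around c: some covered error
    -- qubit q' meets c, and growth passes from q' through c to q.
    obtain ⟨q', hq'x, hcq', hq'⟩ : ∃ q' ∈ x, H c q' ≠ 0 ∧ q' ∉ N := by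
      by_contra! hcon
      exact hcx ((mem_syndrome_congr fun q' h' =>
        ⟨fun h => uncovered_subset x k h, fun h => hcon q' h h'⟩).mp hc)
    have hq'g : Sum.inl q' ∈ grown H (syndrome H x) k := by
      by_contra h
      exact hq' (mem_uncovered.mpr ⟨hq'x, h⟩)
    have hqg : Sum.inl q ∈ grown H (syndrome H x) (k + 2) :=
      mem_grown_succ_of_adj (mem_grown_succ_of_adj (v := Sum.inr c) hq'g (by simpa)) (by simpa)
    simp only [Finset.coe_biUnion, Set.mem_iUnion]
    exact ⟨q, by simpa [hqN] using fun h => (mem_uncovered.mp h).2 hqg, by simpa⟩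
  have h1 := Set.ncard_le_ncard hsyn (Finset.finite_toSet _)
  rw [Set.ncard_coe_finset] at h1
  have h2 := h1.trans (Finset.card_biUnion_le_card_mul _ _ D fun q _ => by
    have := hD.2 q
    rw [({c | H c q ≠ 0}.toFinite).encard_eq_coe_toFinset_card] at this
    exact_mod_cast this)
  have h3 := Finset.card_sdiff_add_card_eq_card hsub
  rw [mul_comm] at h2
  rw [← h3, mul_add]
  omega

theorem IsSound.card_uncovered_le [Finite R] {S : Submodule (ZMod 2) (Q → ZMod 2)} {M D : ℕ}
    (hD : IsSparse H D) (hD0 : 0 < D) (h : IsSound H S M D) {x : Finset Q}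
    (hx : IsReduced S x) (hM : x.card ≤ M) (r : ℕ) :
    ((uncovered H x (2 * r + 1)).card : ℝ) ≤ (1 - 1 / (D : ℝ) ^ 2) ^ r * x.card := by
  have hD1 : (1 : ℝ) ≤ D := by exact_mod_cast hD0
  have hρ : 0 ≤ 1 - 1 / (D : ℝ) ^ 2 := by
    rw [sub_nonneg, div_le_one (by positivity)]
    exact one_le_pow₀ hD1
  induction r with
  | zero => simpa using Finset.card_le_card (uncovered_subset x 1)
  | succ r ih =>
    have h1 := ncard_syndrome_uncovered_le hD x (2 * r + 1) (by omega)
    have h2 := h _ (hx.subset (uncovered_subset (H := H) x (2 * r + 1)))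
      ((Finset.card_le_card (uncovered_subset x _)).trans hM)
    rw [show 2 * (r + 1) + 1 = 2 * r + 1 + 2 by ring]
    set N := uncovered H x (2 * r + 1)
    set N' := uncovered H x (2 * r + 1 + 2)
    have h3 : N.card + D ^ 2 * N'.card ≤ D ^ 2 * N.card := by
      calc N.card + D ^ 2 * N'.card ≤ D * (syndrome H N).ncard + D ^ 2 * N'.card := by gcongr
        _ = D * ((syndrome H N).ncard + D * N'.card) := by ring
        _ ≤ D * (D * N.card) := by gcongr
        _ = D ^ 2 * N.card := by ring
    have h4 : (N.card : ℝ) + D ^ 2 * N'.card ≤ D ^ 2 * N.card := by exact_mod_cast h3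
    have h5 : (N'.card : ℝ) ≤ (1 - 1 / (D : ℝ) ^ 2) * N.card := by
      have hpos : 0 < (D : ℝ) ^ 2 := by positivity
      rw [← mul_le_mul_iff_right₀ hpos]
      have : (D : ℝ) ^ 2 * ((1 - 1 / (D : ℝ) ^ 2) * N.card) = D ^ 2 * N.card - N.card := by
        field_simp
      linarith
    calc (N'.card : ℝ) ≤ (1 - 1 / (D : ℝ) ^ 2) * N.card := h5
      _ ≤ (1 - 1 / (D : ℝ) ^ 2) * ((1 - 1 / (D : ℝ) ^ 2) ^ r * x.card) := by gcongr
      _ = _ := by ring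

end Covering

/-! ### Correction of small errors -/

section Correction

variable {Q RX RZ : Type*} [Fintype Q]

theorem CSSCode.mulVec_eq_zero_of_mem_span [Fintype RX] (C : CSSCode Q RX RZ) {s : Q → ZMod 2}
    (hs : s ∈ Submodule.span (ZMod 2) (Set.range C.HX.row)) : C.HZ.mulVec s = 0 := by
  induction hs using Submodule.span_induction with
  | mem s hs =>
    obtain ⟨i, rfl⟩ := hs
    ext c
    have := congrFun (congrFun C.orthogonal i) c
    rw [Matrix.mul_apply] at this
    simpa [Matrix.mulVec, dotProduct, mul_comm] using this
  | zero => exact Matrix.mulVec_zero _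
  | add s t _ _ hs ht => rw [Matrix.mulVec_add, hs, ht, add_zero]
  | smul a s _ hs => rw [Matrix.mulVec_smul, hs, smul_zero]

/-- If the code is sound up to weight `M`, the Union-Find decoder corrects every error whose
weight is at most a constant times a fixed root of `M`. -/
theorem CSSCode.unionFindCorrectsX_of_isSound [Fintype RX] [Finite RZ] (C : CSSCode Q RX RZ)
    {M D κ : ℕ} (hD0 : 0 < D) (hD : IsSparse C.HZ D)
    (hsound : IsSound C.HZ (Submodule.span (ZMod 2) (Set.range C.HX.row)) M D)
    (hκ : (1 - 1 / (D : ℝ) ^ 2) ^ κ * ((D : ℝ) + 1) ^ 2 ≤ 1) (x : Finset Q)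
    (hx : 2 * D * (D + 1) ^ 4 * x.card ^ (κ + 1) ≤ M) : C.UnionFindCorrectsX x := by
  classical
  have hS : ∀ s ∈ Submodule.span (ZMod 2) (Set.range C.HX.row), C.HZ.mulVec s = 0 :=
    fun s hs => C.mulVec_eq_zero_of_mem_span hs
  obtain ⟨z, hz, hxz, hzx⟩ := exists_isReduced (Submodule.span (ZMod 2) (Set.range C.HX.row)) x
  have hsyn := syndrome_eq_of_add_mem hS hxz
  unfold CSSCode.UnionFindCorrectsX
  rw [hsyn]
  have hzM : 2 * D * (D + 1) ^ 4 * z.card ^ (κ + 1) ≤ M :=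
    le_trans (by gcongr) hx
  have hzcard : z.card ≤ z.card ^ (κ + 1) := Nat.le_self_pow (by omega) _
  have hzM' : z.card ≤ M := by
    refine hzcard.trans (le_trans ?_ hzM)
    exact Nat.le_mul_of_pos_left _ (by positivity)
  obtain ⟨k, hk, hkcard⟩ : ∃ k, AllComponentsValid C.HZ (syndrome C.HZ z)
      (grown C.HZ (syndrome C.HZ z) k) ∧ (D + 1) ^ k * z.card ≤ (D + 1) ^ 4 * z.card ^ (κ + 1) := by
    set ρ : ℝ := 1 - 1 / (D : ℝ) ^ 2 with hρdef
    have hD1 : (1 : ℝ) ≤ D := by exact_mod_cast hD0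
    have hρ0 : 0 ≤ ρ := by
      rw [hρdef, sub_nonneg, div_le_one (by positivity)]
      exact one_le_pow₀ hD1
    have hρ1 : ρ < 1 := by
      have : 0 < 1 / (D : ℝ) ^ 2 := by positivity
      linarith
    obtain rfl | hne := z.eq_empty_or_nonempty
    · exact ⟨0, allComponentsValid_of_subset_interior (by simp), by simp⟩
    have hex : ∃ r : ℕ, ρ ^ r * z.card < 1 := by
      obtain ⟨r, hr⟩ := exists_pow_lt_of_lt_one (show 0 < 1 / (z.card + 1 : ℝ) by positivity) hρ1
      refine ⟨r, ?_⟩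
      rw [lt_div_iff₀ (by positivity)] at hr
      nlinarith [pow_nonneg hρ0 r]
    -- With r + 1 the least exponent for which ρ ^ (r + 1) * |z| < 1, integrality empties the
    -- uncovered set, while minimality keeps 1 ≤ ρ ^ r * |z|, which bounds r from above.
    have hr := Nat.find_spec hex
    obtain ⟨r, hr'⟩ : ∃ r, Nat.find hex = r + 1 := by
      refine Nat.exists_eq_succ_of_ne_zero fun h => ?_
      rw [h, pow_zero, one_mul] at hr
      have := hne.card_pos
      exact absurd hr (by exact_mod_cast not_lt.mpr this)
    have hmin : 1 ≤ ρ ^ r * z.card := not_lt.mp (Nat.find_min hex (by omega))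
    rw [hr'] at hr
    have hcov := hsound.card_uncovered_le hD hD0 hz hzM' (r + 1)
    have hempty : uncovered C.HZ z (2 * (r + 1) + 1) = ∅ := by
      rw [← Finset.card_eq_zero, ← Nat.lt_one_iff]
      exact_mod_cast hcov.trans_lt hr
    -- After 2 * (r + 1) + 1 rounds all qubits of z are covered; one more round absorbs their
    -- neighbours and puts them in the interior.
    refine ⟨2 * (r + 1) + 2, allComponentsValid_of_subset_interior fun q hq => ?_, ?_⟩
    · have hg : Sum.inl q ∈ grown C.HZ (syndrome C.HZ z) (2 * (r + 1) + 1) := by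
        by_contra h
        have := mem_uncovered.mpr ⟨hq, h⟩
        simp [hempty] at this
      exact mem_interior_iff.mpr ⟨grown_subset_succ _ _ hg, fun v hv => mem_grown_succ_of_adj hg hv⟩
    -- The choice of κ makes the growth factor (D + 1) ^ 2 per two rounds at most ρ ^ (-κ), so the
    -- total growth is paid for by the κ-th power of 1 ≤ ρ ^ r * |z|.
    · have h1 : (((D : ℝ) + 1) ^ 2) ^ r ≤ (z.card : ℝ) ^ κ := by
        calc (((D : ℝ) + 1) ^ 2) ^ r ≤ (((D : ℝ) + 1) ^ 2) ^ r * (ρ ^ r * z.card) ^ κ :=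
              le_mul_of_one_le_right (by positivity) (one_le_pow₀ hmin)
          _ = (ρ ^ κ * ((D : ℝ) + 1) ^ 2) ^ r * (z.card : ℝ) ^ κ := by
              rw [mul_pow, mul_pow, ← pow_mul ρ, ← pow_mul ρ, mul_comm r κ]
              ring
          _ ≤ 1 * (z.card : ℝ) ^ κ := by
              gcongr
              exact pow_le_one₀ (by positivity) hκ
          _ = _ := one_mul _
      have h2 : ((D + 1) ^ 2) ^ r ≤ z.card ^ κ := by exact_mod_cast h1
      calc (D + 1) ^ (2 * (r + 1) + 2) * z.card = (D + 1) ^ 4 * (((D + 1) ^ 2) ^ r * z.card) := by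
            rw [← pow_mul]
            ring
        _ ≤ (D + 1) ^ 4 * (z.card ^ κ * z.card) := by gcongr
        _ = _ := by rw [pow_succ z.card]
  refine ⟨exists_isUnionFindOutput hk, fun y hy => ?_⟩
  have hycard : y.card ≤ D * ((D + 1) ^ k * z.card) := by
    have h1 : (Sum.inl '' (y : Set Q) : Set (Q ⊕ RZ)) ⊆ grown C.HZ (syndrome C.HZ z) k := by
      rintro _ ⟨q, hq, rfl⟩
      exact hy.mem_grown hk hq
    have h2 := Set.ncard_le_ncard h1 (Set.toFinite _)
    rw [Set.ncard_image_of_injective _ Sum.inl_injective, Set.ncard_coe_finset] at h2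
    calc y.card ≤ (D + 1) ^ k * (syndrome C.HZ z).ncard := h2.trans (ncard_grown_le hD _ k)
      _ ≤ (D + 1) ^ k * (D * z.card) := by
          gcongr
          exact ncard_syndrome_le hD z
      _ = _ := by ring
  have hzy : errorVector (z ∆ y) ∈ Submodule.span (ZMod 2) (Set.range C.HX.row) := by
    refine hsound.mem_of_syndrome_eq_empty hS ((card_symmDiff_le z y).trans ?_) ?_
    · have h1 : D * ((D + 1) ^ k * z.card) ≤ D * ((D + 1) ^ 4 * z.card ^ (κ + 1)) := by gcongr
      have h2 : z.card ≤ D * ((D + 1) ^ 4 * z.card ^ (κ + 1)) := by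
        rw [← mul_assoc]
        exact hzcard.trans (Nat.le_mul_of_pos_left _ (by positivity))
      calc z.card + y.card ≤ 2 * D * (D + 1) ^ 4 * z.card ^ (κ + 1) := by
            rw [show 2 * D * (D + 1) ^ 4 * z.card ^ (κ + 1)
              = 2 * (D * ((D + 1) ^ 4 * z.card ^ (κ + 1))) by ring]
            omega
        _ ≤ M := hzM
    · rw [syndrome_symmDiff, hy.syndrome_eq, symmDiff_self, Set.bot_eq_empty]
  rw [errorVector_symmDiff] at hzy
  have := Submodule.add_mem _ hxz hzy
  rwa [show errorVector x + errorVector z + (errorVector z + errorVector y)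
    = errorVector x + errorVector y + (errorVector z + errorVector z) by abel,
    add_self_eq_zero_of_zmod_two, add_zero] at this

end Correction

/-! ### Unique neighbours -/

open Classical in
-- Double counting: there are Δ|S| edges, and each neighbour that is not unique takes at least two.
-- So the number of unique neighbours is at least 2|Γ(S)| - Δ|S| ≥ (1 - 2δ)Δ|S| > (2/3)Δ|S|, and
-- some vertex does at least as well as the average.
theorem exists_many_unique_neighbors {A B : Type*} [Fintype B] {G : A → B → Prop}
    {Δ : ℕ} {δ : ℝ} (hΔ : 1 ≤ Δ) (hδ : δ < 1 / 6)
    (hdeg : ∀ a, (Finset.univ.filter fun b => G a b).card = Δ) {S : Finset A} (hS : S.Nonempty)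
    (hexp : (1 - δ) * Δ * S.card ≤ ((Finset.univ.filter fun b => ∃ a ∈ S, G a b).card : ℝ)) :
    ∃ a ∈ S, ∃ U : Finset B, (∀ b, b ∈ U ↔ G a b ∧ ∀ a' ∈ S, G a' b → a' = a) ∧
      2 * Δ < 3 * U.card := by
  by_contra! hno
  have hcon : ∀ a ∈ S, 3 * (Finset.univ.filter fun b =>
      G a b ∧ ∀ a' ∈ S, G a' b → a' = a).card ≤ 2 * Δ :=
    fun a ha => hno a ha _ fun b => by simp
  have hpoint : ∀ b : B, 2 * (if ∃ a ∈ S, G a b then 1 else 0) ≤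
      (S.filter fun a => G a b).card
        + (S.filter fun a => G a b ∧ ∀ a' ∈ S, G a' b → a' = a).card := by
    intro b
    split_ifs with h
    · obtain ⟨a, ha, hab⟩ := h
      have hpos : a ∈ S.filter fun a => G a b := Finset.mem_filter.mpr ⟨ha, hab⟩
      by_cases h1 : (S.filter fun a => G a b).card = 1
      · obtain ⟨a₀, ha₀⟩ := Finset.card_eq_one.mp h1
        have huniq : ∀ a' ∈ S, G a' b → a' = a₀ := fun a' h' hb => by
          rw [← Finset.mem_singleton, ← ha₀]
          exact Finset.mem_filter.mpr ⟨h', hb⟩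
        have ha : a ∈ S.filter fun a => G a b ∧ ∀ a' ∈ S, G a' b → a' = a := by
          rw [Finset.mem_filter]
          exact ⟨ha, hab, fun a' h' hb => (huniq a' h' hb).trans (huniq a ha hab).symm⟩
        have := Finset.card_pos.mpr ⟨a, ha⟩
        omega
      · have := Finset.card_pos.mpr ⟨a, hpos⟩
        omega
    · simp
  have hsum := Finset.sum_le_sum fun b (_ : b ∈ Finset.univ) => hpoint b
  rw [← Finset.mul_sum, ← Finset.card_filter, Finset.sum_add_distrib] at hsum
  have e1 := Finset.sum_card_bipartiteAbove_eq_sum_card_bipartiteBelow (s := S)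
    (t := (Finset.univ : Finset B)) fun a b => G a b
  have e2 := Finset.sum_card_bipartiteAbove_eq_sum_card_bipartiteBelow (s := S)
    (t := (Finset.univ : Finset B)) fun a b => G a b ∧ ∀ a' ∈ S, G a' b → a' = a
  simp only [Finset.bipartiteAbove, Finset.bipartiteBelow] at e1 e2
  rw [← e1, ← e2, Finset.sum_congr rfl fun a _ => hdeg a, Finset.sum_const, smul_eq_mul] at hsum
  have hle := Finset.sum_le_sum hcon
  rw [← Finset.mul_sum, Finset.sum_const, smul_eq_mul] at hle
  have hsum' : 2 * ((Finset.univ.filter fun b => ∃ a ∈ S, G a b).card : ℝ) ≤ S.card * Δ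
      + (∑ a ∈ S, (Finset.univ.filter fun b => G a b ∧ ∀ a' ∈ S, G a' b → a' = a).card : ℕ) := by
    exact_mod_cast hsum
  have hle' : 3 * ((∑ a ∈ S, (Finset.univ.filter fun b =>
      G a b ∧ ∀ a' ∈ S, G a' b → a' = a).card : ℕ) : ℝ) ≤ S.card * (2 * Δ) := by
    exact_mod_cast hle
  have hpos : 0 < (Δ : ℝ) * S.card := by
    have := hS.card_pos
    positivity
  nlinarith

/-! ### Unsatisfied checks of the hypergraph product -/

section Product

variable {A B : Type*} [Fintype A] [Fintype B]

open Classical in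
/-- The number of qubits of the error `(EA, EB)` incident to the `Z` check `c`. -/
noncomputable def checkDegree (G : A → B → Prop) (EA : Finset (A × A)) (EB : Finset (B × B))
    (c : B × A) : ℕ :=
  (Finset.univ.filter fun a => G a c.1 ∧ (a, c.2) ∈ EA).card
    + (Finset.univ.filter fun b => G c.2 b ∧ (c.1, b) ∈ EB).card

open Classical in
/-- The `Z` checks violated by the error `(EA, EB)`. -/
noncomputable def unsatisfied (G : A → B → Prop) (EA : Finset (A × A)) (EB : Finset (B × B)) :
    Finset (B × A) :=
  Finset.univ.filter fun c => Odd (checkDegree G EA EB c)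

theorem mem_unsatisfied {G : A → B → Prop} {EA : Finset (A × A)} {EB : Finset (B × B)}
    {c : B × A} : c ∈ unsatisfied G EA EB ↔ Odd (checkDegree G EA EB c) := by
  classical
  simp [unsatisfied]

theorem card_filter_eq_ite {α : Type*} [Fintype α] {p : α → Prop} [DecidablePred p] {a : α}
    {r : Prop} [Decidable r] (h : ∀ x, p x ↔ x = a ∧ r) :
    (Finset.univ.filter p).card = if r then 1 else 0 := by
  by_cases hr : r
  · rw [if_pos hr, Finset.card_eq_one]
    exact ⟨a, by ext x; simp [h, hr]⟩
  · rw [if_neg hr, Finset.card_eq_zero]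
    ext x
    simp [h, hr]

/-- For checks that meet each half of the error in at most one known qubit: r and s record whether
that qubit is present, and odd parity becomes exclusive or. -/
theorem mem_unsatisfied_of_iff {G : A → B → Prop} {EA : Finset (A × A)} {EB : Finset (B × B)}
    {a α : A} {b β : B} {r s : Prop} (hA : ∀ x, G x β ∧ (x, α) ∈ EA ↔ x = a ∧ r)
    (hB : ∀ x, G α x ∧ (β, x) ∈ EB ↔ x = b ∧ s) :
    (β, α) ∈ unsatisfied G EA EB ↔ (r ∧ ¬ s) ∨ (¬ r ∧ s) := by
  classical
  have h1 := card_filter_eq_ite hA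
  have h2 := card_filter_eq_ite hB
  have h : checkDegree G EA EB (β, α) = (if r then 1 else 0) + if s then 1 else 0 := by
    rw [← h1, ← h2, checkDegree]
  rw [mem_unsatisfied, h]
  by_cases hr : r <;> by_cases hs : s <;> simp [hr, hs]

theorem mem_unsatisfied_generator {G : A → B → Prop} {a : A}
    {b : B} {Q : Finset B} {Q' : Finset A} (hQ : ∀ β ∈ Q, G a β) (hQ' : ∀ α ∈ Q', G α b)
    {β : B} {α : A} : (β, α) ∈ unsatisfied G ({a} ×ˢ Q') (Q ×ˢ {b}) ↔
      (G a β ∧ G α b) ∧ ((α ∈ Q' ∧ β ∉ Q) ∨ (α ∉ Q' ∧ β ∈ Q)) := by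
  rw [mem_unsatisfied_of_iff (a := a) (b := b) (r := G a β ∧ α ∈ Q') (s := G α b ∧ β ∈ Q)]
  · have := hQ β
    have := hQ' α
    tauto
  · intro x
    simp only [Finset.mem_product, Finset.mem_singleton]
    constructor
    · rintro ⟨h, rfl, h'⟩
      exact ⟨rfl, h, h'⟩
    · rintro ⟨rfl, h, h'⟩
      exact ⟨h, rfl, h'⟩
  · intro x
    simp only [Finset.mem_product, Finset.mem_singleton]
    constructor
    · rintro ⟨h, h', rfl⟩
      exact ⟨rfl, h, h'⟩
    · rintro ⟨rfl, h, h'⟩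
      exact ⟨h, h', rfl⟩

/-- A flip inside a generator lowers the syndrome weight if sufficiently many of the checks that
it changes are violated. -/
theorem exists_flip_of_generator [DecidableEq A] [DecidableEq B] {G : A → B → Prop} {ΔA ΔB : ℕ}
    (hG : IsBiregular G ΔA ΔB) {X : Finset (B × A)} {a : A} {b : B} {U Q : Finset B}
    {U' Q' : Finset A} (hU : ∀ β ∈ U, G a β) (hU' : ∀ α ∈ U', G α b) (hQ : Q ⊆ U)
    (hQ' : Q' ⊆ U') (h1 : ∀ β ∈ Q, ∀ α ∈ U', α ∉ Q' → (β, α) ∈ X)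
    (h2 : ∀ β ∈ U, β ∉ Q → ∀ α ∈ Q', (β, α) ∈ X)
    (hlt : Q.card * (ΔB - Q'.card) + (ΔA - Q.card) * Q'.card
      < 2 * (Q.card * (U'.card - Q'.card) + (U.card - Q.card) * Q'.card)) :
    ∃ (FA : Finset (A × A)) (FB : Finset (B × B)), FA.card + FB.card ≤ ΔA + ΔB ∧
      (unsatisfied G FA FB).card < 2 * (unsatisfied G FA FB ∩ X).card := by
  classical
  have hΓ : Q ⊆ Finset.univ.filter fun β => G a β := fun β hβ => by simpa using hU β (hQ hβ)
  have hΓ' : Q' ⊆ Finset.univ.filter fun α => G α b := fun α hα => by simpa using hU' α (hQ' hα)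
  have hmem : ∀ β α, (β, α) ∈ unsatisfied G ({a} ×ˢ Q') (Q ×ˢ {b}) ↔ _ := fun β α =>
    mem_unsatisfied_generator (fun β hβ => hU β (hQ hβ)) (fun α hα => hU' α (hQ' hα))
  refine ⟨{a} ×ˢ Q', Q ×ˢ {b}, ?_, ?_⟩
  · have h1 := Finset.card_le_card hΓ
    have h2 := Finset.card_le_card hΓ'
    rw [hG.1 a] at h1
    rw [hG.2 b] at h2
    simp only [Finset.card_product, Finset.card_singleton]
    omega
  -- The flip changes exactly the checks of Γ(a) × Γ(b) with exactly one coordinate in Q or Q'.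
  -- Those within U × U' are violated by assumption; the inequality `hlt` says that they are more
  -- than half.
  · have hup : unsatisfied G ({a} ×ˢ Q') (Q ×ˢ {b}) ⊆
        Q ×ˢ ((Finset.univ.filter fun α => G α b) \ Q')
          ∪ ((Finset.univ.filter fun β => G a β) \ Q) ×ˢ Q' := by
      rintro ⟨β, α⟩ h
      rw [hmem] at h
      simp only [Finset.mem_union, Finset.mem_product, Finset.mem_sdiff, Finset.mem_filter,
        Finset.mem_univ, true_and]
      tauto
    have hlow : Q ×ˢ (U' \ Q') ∪ (U \ Q) ×ˢ Q' ⊆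
        unsatisfied G ({a} ×ˢ Q') (Q ×ˢ {b}) ∩ X := by
      rintro ⟨β, α⟩ h
      rw [Finset.mem_inter, hmem]
      simp only [Finset.mem_union, Finset.mem_product, Finset.mem_sdiff] at h
      rcases h with ⟨hβ, hα, hα'⟩ | ⟨⟨hβ, hβ'⟩, hα⟩
      · exact ⟨⟨⟨hU β (hQ hβ), hU' α hα⟩, Or.inr ⟨hα', hβ⟩⟩, h1 β hβ α hα hα'⟩
      · exact ⟨⟨⟨hU β hβ, hU' α (hQ' hα)⟩, Or.inl ⟨hα, hβ'⟩⟩, h2 β hβ hβ' α hα⟩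
    have hdisj : Disjoint (Q ×ˢ (U' \ Q')) ((U \ Q) ×ˢ Q') := by
      rw [Finset.disjoint_left]
      rintro ⟨β, α⟩ h h'
      simp only [Finset.mem_product, Finset.mem_sdiff] at h h'
      exact h'.1.2 h.1
    have hc1 := (Finset.card_le_card hup).trans (Finset.card_union_le _ _)
    have hc2 := Finset.card_le_card hlow
    rw [Finset.card_union_of_disjoint hdisj] at hc2
    simp only [Finset.card_product] at hc1 hc2
    rw [Finset.card_sdiff_of_subset hΓ, Finset.card_sdiff_of_subset hΓ', hG.1 a, hG.2 b] at hc1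
    rw [Finset.card_sdiff_of_subset hQ, Finset.card_sdiff_of_subset hQ'] at hc2
    omega

/-- The numbers p, q count error qubits among the u, v selected neighbours in a generator with a + b
qubits. The two alternatives are the hypothesis of `exists_flip_of_generator` for flipping the error
part and for flipping its complement in the selected sets. -/
theorem flip_or_complement_decreases {a b u v p q : ℕ} (hpu : p ≤ u) (hua : u ≤ a) (hqv : q ≤ v)
    (hvb : v ≤ b) (hu : 2 * a < 3 * u) (hv : 2 * b < 3 * v) (hp : 0 < p)
    (hred : 2 * (p + q) ≤ a + b) :
    p * (b - q) + (a - p) * q < 2 * (p * (v - q) + (u - p) * q) ∨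
      (u - p) * (b - (v - q)) + (a - (u - p)) * (v - q)
        < 2 * ((u - p) * (v - (v - q)) + (u - (u - p)) * (v - q)) := by
  have e1 : v - (v - q) = q := by omega
  have e2 : u - (u - p) = p := by omega
  have e3 : b - (v - q) = b - v + q := by omega
  have e4 : a - (u - p) = a - u + p := by omega
  rw [e1, e2, e3, e4]
  have hqb := hqv.trans hvb
  have hpa := hpu.trans hua
  zify [hpu, hqv, hua, hvb, hqb, hpa]
  rify at *
  have ha : (0 : ℝ) < a := by linarith
  have hb : (0 : ℝ) < b := by linarith
  have hq : (0 : ℝ) ≤ q := by positivity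
  -- With x = p/a, y = q/b and the extreme values u = 2a/3, v = 2b/3, the first alternative becomes
  -- 6xy ≤ x + y and the second 4 ≤ 9(x + y) - 18xy; strictness comes from u and v exceeding these
  -- values.
  by_cases h : 6 * ((p : ℝ) * q) ≤ p * b + q * a
  · left
    have h1 := mul_pos hp (sub_pos.mpr hv)
    have h2 := mul_nonneg hq (sub_pos.mpr hu).le
    linarith
  · right
    push Not at h
    have key : 4 * ((a : ℝ) * b) ≤ 9 * (p * b + q * a) - 18 * (p * q) := by
      obtain ⟨x, hx⟩ : ∃ x : ℝ, (p : ℝ) = x * a := ⟨p / a, by field_simp⟩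
      obtain ⟨y, hy⟩ : ∃ y : ℝ, (q : ℝ) = y * b := ⟨q / b, by field_simp⟩
      have hab := mul_pos ha hb
      have hx0 : 0 < x := pos_of_mul_pos_left (hx ▸ hp) ha.le
      have hy0 : 0 ≤ y := nonneg_of_mul_nonneg_left (hy ▸ hq) hb
      have hxy : x + y < 6 * (x * y) := by
        rw [hx, hy] at h
        have : (a * b : ℝ) * (x + y) < a * b * (6 * (x * y)) := by linarith
        exact lt_of_mul_lt_mul_left this hab.le
      -- The half-weight bound reads xa + yb ≤ (a + b)/2, so it controls only the smaller of x and
      -- y.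
      have hhalf : x ≤ 1 / 2 ∨ y ≤ 1 / 2 := by
        by_contra! hcon
        rw [hx, hy] at hred
        have h1 := mul_pos (sub_pos.mpr hcon.1) ha
        have h2 := mul_pos (sub_pos.mpr hcon.2) hb
        linarith
      -- If both are at most 1/2, then xy ≤ (x + y)²/4 reduces the claim to a quadratic in x + y
      -- with roots 2/3 and 4/3. Otherwise (1 - 2x)(1 - 2y) ≤ 0 gives the stronger bound 9/2.
      have hgoal : 4 ≤ 9 * (x + y) - 18 * (x * y) := by
        by_cases hx2 : x ≤ 1 / 2 <;> by_cases hy2 : y ≤ 1 / 2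
        · have hs : 2 / 3 < x + y := by
            have h1 : (x + y) * 2 < (x + y) * (3 * (x + y)) := by
              linarith [sq_nonneg (x - y)]
            have := lt_of_mul_lt_mul_left h1 (by positivity)
            linarith
          have h2 := mul_nonneg (sub_pos.mpr hs).le (show 0 ≤ 4 / 3 - (x + y) by linarith)
          linarith [sq_nonneg (x - y)]
        · push Not at hy2
          linarith [mul_nonneg (sub_nonneg.mpr hx2) (sub_pos.mpr hy2).le]
        · push Not at hx2
          linarith [mul_nonneg (sub_nonneg.mpr hy2) (sub_pos.mpr hx2).le]
        · tauto
      rw [hx, hy]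
      linarith [mul_le_mul_of_nonneg_left hgoal hab.le]
    have h1 := mul_pos ha (sub_pos.mpr hv)
    have h2 := mul_pos hb (sub_pos.mpr hu)
    have h3 := mul_pos (sub_pos.mpr hu) (sub_pos.mpr hv)
    linarith

/-- In an expander graph every small nonzero error which occupies at most half of each generator
admits a flip inside a generator that lowers the syndrome weight. -/
theorem exists_flip {G : A → B → Prop} [DecidableEq A] [DecidableEq B] {ΔA ΔB : ℕ}
    {γA δA γB δB : ℝ} (hΔA : 1 ≤ ΔA)
    (hΔB : 1 ≤ ΔB) (hδA : δA < 1 / 6) (hδB : δB < 1 / 6) (hG : IsBiregular G ΔA ΔB)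
    (hL : IsLeftExpanding G ΔA γA δA) (hR : IsRightExpanding G ΔB γB δB)
    {EA : Finset (A × A)} {EB : Finset (B × B)} (hne : EA.Nonempty ∨ EB.Nonempty)
    (hA : (EA.card : ℝ) ≤ γA * Fintype.card A) (hB : (EB.card : ℝ) ≤ γB * Fintype.card B)
    (hred : ∀ c, 2 * checkDegree (fun b a => G a b) EB EA c ≤ ΔA + ΔB) :
    ∃ (FA : Finset (A × A)) (FB : Finset (B × B)), FA.card + FB.card ≤ ΔA + ΔB ∧
      (unsatisfied G FA FB).card < 2 * (unsatisfied G FA FB ∩ unsatisfied G EA EB).card := by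
  classical
  have huniqB : ∀ T : Finset B, T.Nonempty → T ⊆ EB.image Prod.snd → ∃ b ∈ T, ∃ U : Finset A,
      (∀ α, α ∈ U ↔ G α b ∧ ∀ b' ∈ T, G α b' → b' = b) ∧ 2 * ΔB < 3 * U.card :=
    fun T hT hTE => exists_many_unique_neighbors (G := fun b a => G a b) hΔB hδB hG.2 hT
      (hR T ((Nat.cast_le.mpr ((Finset.card_le_card hTE).trans Finset.card_image_le)).trans hB))
  obtain rfl | hEA := EA.eq_empty_or_nonempty
  · have hEB : EB.Nonempty := by simpa using hne
    obtain ⟨b, hb, U', hmemU', hU'⟩ := huniqB _ (hEB.image _) subset_rfl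
    obtain ⟨⟨β, b⟩, hβ, rfl⟩ := Finset.mem_image.mp hb
    obtain ⟨a, ha⟩ : ∃ a, G a β := by
      obtain ⟨a, ha⟩ := Finset.card_pos.mp (hΔB.trans_eq (hG.2 β).symm)
      exact ⟨a, by simpa using ha⟩
    -- Without A-qubits, flipping the single qubit (β, b) is enough: more than two thirds of its
    -- checks meet no other error qubit.
    refine exists_flip_of_generator hG (a := a) (b := b) (U := {β}) (Q := {β}) (U' := U')
      (Q' := ∅) (by simpa) (fun α hα => ((hmemU' α).mp hα).1) subset_rfl
      (Finset.empty_subset _) ?_ (by simp)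
      (by simp only [Finset.card_singleton, Finset.card_empty]; omega)
    intro β' hβ' α hα _
    obtain rfl := Finset.mem_singleton.mp hβ'
    obtain ⟨hαb, hα⟩ := (hmemU' α).mp hα
    rw [mem_unsatisfied_of_iff (a := a) (b := b) (r := False) (s := True) (by simp)]
    · simp
    · intro x
      simp only [and_true]
      constructor
      · rintro ⟨h, h'⟩
        exact hα x (Finset.mem_image.mpr ⟨_, h', rfl⟩) h
      · rintro rfl
        exact ⟨hαb, hβ⟩
  obtain ⟨a, ha, U, hmemU, hU⟩ := exists_many_unique_neighbors hΔA hδA hG.1 (hEA.image Prod.fst)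
    (hL (EA.image Prod.fst) ((Nat.cast_le.mpr Finset.card_image_le).trans hA))
  obtain ⟨⟨a, α₀⟩, hα₀, rfl⟩ := Finset.mem_image.mp ha
  simp only at hU hmemU
  have hUG : ∀ β ∈ U, G a β := fun β hβ => ((hmemU β).mp hβ).1
  have hiffA : ∀ β ∈ U, ∀ α x, G x β ∧ (x, α) ∈ EA ↔ x = a ∧ (a, α) ∈ EA := by
    intro β hβ α x
    obtain ⟨h1, h2⟩ := (hmemU β).mp hβ
    constructor
    · rintro ⟨h, h'⟩
      obtain rfl : x = a := h2 x (Finset.mem_image.mpr ⟨_, h', rfl⟩) h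
      exact ⟨rfl, h'⟩
    · rintro ⟨rfl, h⟩
      exact ⟨h1, h⟩
  -- Only B-qubits with first coordinate in U can meet checks in U × A, so unique neighbours are
  -- needed relative to T alone. Membership b ∈ T also makes the error part P below nonempty.
  set T := (EB.filter fun e => e.1 ∈ U).image Prod.snd
  obtain hT0 | hT0 := T.eq_empty_or_nonempty
  · obtain ⟨b, hb⟩ : ∃ b, G α₀ b := by
      obtain ⟨b, hb⟩ := Finset.card_pos.mp (hΔA.trans_eq (hG.1 α₀).symm)
      exact ⟨b, by simpa using hb⟩
    -- No B-qubit interferes here, so the single qubit (a, α₀) is flipped; b is an arbitrary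
    -- neighbour of α₀.
    refine exists_flip_of_generator hG (a := a) (b := b) (U := U) (Q := ∅) (U' := {α₀})
      (Q' := {α₀}) hUG (by simpa) (Finset.empty_subset _) subset_rfl (by simp) ?_
      (by simp only [Finset.card_singleton, Finset.card_empty]; omega)
    intro β hβ _ α hα
    obtain rfl := Finset.mem_singleton.mp hα
    rw [mem_unsatisfied_of_iff (b := b) (s := False) (hiffA β hβ α)]
    · simpa
    · intro x
      refine iff_of_false (fun h => ?_) (by simp)
      have : x ∈ T := Finset.mem_image.mpr ⟨_, Finset.mem_filter.mpr ⟨h.2, hβ⟩, rfl⟩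
      simp [hT0] at this
  obtain ⟨b, hb, U', hmemU', hU'⟩ :=
    huniqB T hT0 (Finset.image_subset_image (Finset.filter_subset _ _))
  have hUG' : ∀ α ∈ U', G α b := fun α hα => ((hmemU' α).mp hα).1
  have hiffB : ∀ β ∈ U, ∀ α ∈ U', ∀ x, G α x ∧ (β, x) ∈ EB ↔ x = b ∧ (β, b) ∈ EB := by
    intro β hβ α hα x
    obtain ⟨h1, h2⟩ := (hmemU' α).mp hα
    constructor
    · rintro ⟨h, h'⟩
      obtain rfl : x = b :=
        h2 x (Finset.mem_image.mpr ⟨_, Finset.mem_filter.mpr ⟨h', hβ⟩, rfl⟩) h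
      exact ⟨rfl, h'⟩
    · rintro ⟨rfl, h⟩
      exact ⟨h1, h⟩
  have hunsat : ∀ β ∈ U, ∀ α ∈ U', (β, α) ∈ unsatisfied G EA EB ↔
      ((a, α) ∈ EA ∧ (β, b) ∉ EB) ∨ ((a, α) ∉ EA ∧ (β, b) ∈ EB) :=
    fun β hβ α hα => mem_unsatisfied_of_iff (hiffA β hβ α) (hiffB β hβ α hα)
  set P := U.filter fun β => (β, b) ∈ EB
  set P' := U'.filter fun α => (a, α) ∈ EA
  have hPU : P ⊆ U := Finset.filter_subset _ _
  have hPU' : P' ⊆ U' := Finset.filter_subset _ _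
  have hPpos : 0 < P.card := by
    obtain ⟨⟨β, b⟩, hβ, rfl⟩ := Finset.mem_image.mp hb
    obtain ⟨h1, h2⟩ := Finset.mem_filter.mp hβ
    exact Finset.card_pos.mpr ⟨β, Finset.mem_filter.mpr ⟨h2, h1⟩⟩
  have hUcard : U.card ≤ ΔA := by
    rw [← hG.1 a]
    exact Finset.card_le_card fun β hβ => by simpa using hUG β hβ
  have hUcard' : U'.card ≤ ΔB := by
    rw [← hG.2 b]
    exact Finset.card_le_card fun α hα => by simpa using hUG' α hα
  have hPP : 2 * (P.card + P'.card) ≤ ΔA + ΔB := by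
    refine le_trans ?_ (hred (a, b))
    unfold checkDegree
    gcongr
    · exact fun β hβ => by
        have := Finset.mem_filter.mp hβ
        simpa using ⟨hUG β this.1, this.2⟩
    · exact fun α hα => by
        have := Finset.mem_filter.mp hα
        simpa using ⟨hUG' α this.1, this.2⟩
  rcases flip_or_complement_decreases (Finset.card_le_card hPU) hUcard
    (Finset.card_le_card hPU') hUcard' hU hU' hPpos hPP with h | h
  · refine exists_flip_of_generator hG hUG hUG' hPU hPU' ?_ ?_ h
    · intro β hβ α hα hα'
      rw [hunsat β (hPU hβ) α hα]
      exact Or.inr ⟨fun h => hα' (Finset.mem_filter.mpr ⟨hα, h⟩), (Finset.mem_filter.mp hβ).2⟩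
    · intro β hβ hβ' α hα
      rw [hunsat β hβ α (hPU' hα)]
      exact Or.inl ⟨(Finset.mem_filter.mp hα).2, fun h => hβ' (Finset.mem_filter.mpr ⟨hβ, h⟩)⟩
  · refine exists_flip_of_generator hG hUG hUG' (Q := U \ P) (Q' := U' \ P')
      Finset.sdiff_subset Finset.sdiff_subset ?_ ?_ ?_
    · intro β hβ α hα hα'
      obtain ⟨hβ, hβP⟩ := Finset.mem_sdiff.mp hβ
      have hαP : α ∈ P' := by
        by_contra hαP
        exact hα' (Finset.mem_sdiff.mpr ⟨hα, hαP⟩)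
      rw [hunsat β hβ α hα]
      exact Or.inl ⟨(Finset.mem_filter.mp hαP).2, fun h => hβP (Finset.mem_filter.mpr ⟨hβ, h⟩)⟩
    · intro β hβ hβ' α hα
      obtain ⟨hα, hαP⟩ := Finset.mem_sdiff.mp hα
      have hβP : β ∈ P := by
        by_contra hβP
        exact hβ' (Finset.mem_sdiff.mpr ⟨hβ, hβP⟩)
      rw [hunsat β hβ α hα]
      exact Or.inr ⟨fun h => hαP (Finset.mem_filter.mpr ⟨hα, h⟩), (Finset.mem_filter.mp hβP).2⟩
    · rwa [Finset.card_sdiff_of_subset hPU, Finset.card_sdiff_of_subset hPU']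

end Product

/-! ### Small-set flips for hypergraph product codes -/

section Submatrix

variable {Q Q' R : Type*}

theorem card_filter_submatrix (H : Matrix R Q' (ZMod 2)) (e : Q ≃ Q') (x : Finset Q) (c : R) :
    (x.filter fun q => H.submatrix id e c q ≠ 0).card
      = ((x.map e.toEmbedding).filter fun q => H c q ≠ 0).card := by
  rw [Finset.filter_map, Finset.card_map]
  rfl

theorem syndrome_submatrix (H : Matrix R Q' (ZMod 2)) (e : Q ≃ Q') (x : Finset Q) :
    syndrome (H.submatrix id e) x = syndrome H (x.map e.toEmbedding) := by
  ext c
  simp only [syndrome, Set.mem_ofPred_eq, card_filter_submatrix]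

/-- Adding the generator c to x replaces their intersection by the rest of the generator, which
cannot lower the weight. -/
theorem IsReduced.two_mul_card_filter_le [Fintype Q] {H : Matrix R Q (ZMod 2)} {x : Finset Q}
    (hx : IsReduced (Submodule.span (ZMod 2) (Set.range H.row)) x) (c : R) :
    2 * (x.filter fun q => H c q ≠ 0).card ≤ (Finset.univ.filter fun q => H c q ≠ 0).card := by
  classical
  set g := Finset.univ.filter fun q => H c q ≠ 0 with hg
  have hrow : errorVector g = H.row c := by
    ext q
    have h01 : ∀ z : ZMod 2, (if z ≠ 0 then 1 else 0) = z := by decide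
    rw [errorVector_apply, hg]
    simpa using h01 (H c q)
  have h := hx (x ∆ g) (by
    rw [errorVector_symmDiff, ← add_assoc, add_self_eq_zero_of_zmod_two, zero_add, hrow]
    exact Submodule.subset_span ⟨c, rfl⟩)
  have h1 : (x.filter fun q => H c q ≠ 0) = x ∩ g := by
    ext q
    simp [hg]
  have h2 : (x ∆ g).card = (x \ g).card + (g \ x).card :=
    Finset.card_union_of_disjoint disjoint_sdiff_sdiff
  have h3 := Finset.card_sdiff_add_card_inter x g
  have h4 := Finset.card_sdiff_add_card_inter g x
  rw [Finset.inter_comm] at h4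
  rw [h1]
  omega

end Submatrix

section Product

variable {A B : Type*}

theorem productHZ_inl_ne_zero {G : A → B → Prop} {c : B × A} {e : A × A} :
    productHZ G c (Sum.inl e) ≠ 0 ↔ G e.1 c.1 ∧ e.2 = c.2 := by
  simp [productHZ, parityCheck, Matrix.one_apply, eq_comm, and_comm]

theorem productHZ_inr_ne_zero {G : A → B → Prop} {c : B × A} {e : B × B} :
    productHZ G c (Sum.inr e) ≠ 0 ↔ G c.2 e.2 ∧ e.1 = c.1 := by
  simp [productHZ, parityCheck, Matrix.one_apply, eq_comm]

/-- Reversing G exchanges the two check types up to swapping the qubit summands. This is why later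
statements carry an equivalence e: the Z case is the X case of the reversed graph. -/
theorem productHX_eq_submatrix (G : A → B → Prop) :
    productHX G = (productHZ fun b a => G a b).submatrix id (Equiv.sumComm (A × A) (B × B)) := by
  ext c (e | e) <;> simp [productHX, productHZ, parityCheck]

theorem productHZ_eq_submatrix (G : A → B → Prop) :
    productHZ G = (productHX fun b a => G a b).submatrix id (Equiv.sumComm (A × A) (B × B)) := by
  ext c (e | e) <;> simp [productHX, productHZ, parityCheck]

variable [Fintype A] [Fintype B]

theorem card_filter_productHZ (G : A → B → Prop) (x : Finset ((A × A) ⊕ (B × B))) (c : B × A) :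
    (x.filter fun q => productHZ G c q ≠ 0).card = checkDegree G x.toLeft x.toRight c := by
  classical
  rw [← Finset.card_toLeft_add_card_toRight, checkDegree]
  congr 1
  · refine Eq.trans (congrArg Finset.card ?_)
      (Finset.card_image_of_injective _ (Prod.mk_left_injective c.2))
    ext ⟨a, a'⟩
    simp only [Finset.mem_toLeft, Finset.mem_filter, productHZ_inl_ne_zero, Finset.mem_image,
      Finset.mem_univ, true_and, Prod.mk.injEq]
    constructor
    · rintro ⟨h, h', rfl⟩
      exact ⟨a, ⟨h', h⟩, rfl, rfl⟩
    · rintro ⟨_, ⟨h, h'⟩, rfl, rfl⟩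
      exact ⟨h', h, rfl⟩
  · refine Eq.trans (congrArg Finset.card ?_)
      (Finset.card_image_of_injective _ (Prod.mk_right_injective c.1))
    ext ⟨b, b'⟩
    simp only [Finset.mem_toRight, Finset.mem_filter, productHZ_inr_ne_zero, Finset.mem_image,
      Finset.mem_univ, true_and, Prod.mk.injEq]
    constructor
    · rintro ⟨h, h', rfl⟩
      exact ⟨b', ⟨h', h⟩, rfl, rfl⟩
    · rintro ⟨_, ⟨h, h'⟩, rfl, rfl⟩
      exact ⟨h', h, rfl⟩

theorem card_filter_productHX (G : A → B → Prop) (x : Finset ((A × A) ⊕ (B × B))) (c : A × B) :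
    (x.filter fun q => productHX G c q ≠ 0).card
      = checkDegree (fun b a => G a b) x.toRight x.toLeft c := by
  rw [productHX_eq_submatrix, card_filter_submatrix, card_filter_productHZ]
  congr 1 <;> ext e <;> simp

theorem syndrome_productHZ (G : A → B → Prop) (x : Finset ((A × A) ⊕ (B × B))) :
    syndrome (productHZ G) x = unsatisfied G x.toLeft x.toRight := by
  ext c
  rw [Finset.mem_coe, mem_unsatisfied, ← card_filter_productHZ]
  exact Iff.rfl

theorem checkDegree_univ {G : A → B → Prop} {ΔA ΔB : ℕ} (hG : IsBiregular G ΔA ΔB) (c : B × A) :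
    checkDegree G Finset.univ Finset.univ c = ΔB + ΔA := by
  refine congrArg₂ (· + ·) ?_ ?_
  · refine (congrArg Finset.card ?_).trans (hG.2 c.1)
    ext
    simp
  · refine (congrArg Finset.card ?_).trans (hG.1 c.2)
    ext
    simp

theorem IsBiregular.swap {G : A → B → Prop} {ΔA ΔB : ℕ} (hG : IsBiregular G ΔA ΔB) :
    IsBiregular (fun b a => G a b) ΔB ΔA :=
  ⟨hG.2, hG.1⟩

theorem isSparse_productHZ {G : A → B → Prop} {ΔA ΔB : ℕ} (hG : IsBiregular G ΔA ΔB) :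
    IsSparse (productHZ G) (ΔA + ΔB) := by
  classical
  constructor
  · intro c
    rw [Set.encard_eq_coe_toFinset_card, Set.toFinset_ofPred, card_filter_productHZ]
    have : (Finset.univ : Finset ((A × A) ⊕ (B × B))).toLeft = Finset.univ := by ext; simp
    rw [this]
    have : (Finset.univ : Finset ((A × A) ⊕ (B × B))).toRight = Finset.univ := by ext; simp
    rw [this, checkDegree_univ hG, add_comm]
  · rintro (⟨a, a'⟩ | ⟨b, b'⟩)
    · have hsub : {c | productHZ G c (Sum.inl (a, a')) ≠ 0} ⊆
          ((Finset.univ.filter fun b => G a b).image fun b => (b, a') : Finset (B × A)) := by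
        rintro ⟨b, α⟩ h
        obtain ⟨h1, h2⟩ := productHZ_inl_ne_zero.mp h
        simpa using ⟨h1, h2⟩
      refine (Set.encard_le_encard hsub).trans ?_
      rw [Set.encard_coe_eq_coe_finsetCard]
      have := (Finset.card_image_le (s := Finset.univ.filter fun b => G a b)
        (f := fun b => (b, a'))).trans (hG.1 a).le
      exact_mod_cast this.trans (Nat.le_add_right _ _)
    · have hsub : {c | productHZ G c (Sum.inr (b, b')) ≠ 0} ⊆
          ((Finset.univ.filter fun a => G a b').image fun a => (b, a) : Finset (B × A)) := by
        rintro ⟨β, a⟩ h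
        obtain ⟨h1, h2⟩ := productHZ_inr_ne_zero.mp h
        simpa using ⟨h1, h2⟩
      refine (Set.encard_le_encard hsub).trans ?_
      rw [Set.encard_coe_eq_coe_finsetCard]
      have := (Finset.card_image_le (s := Finset.univ.filter fun a => G a b')
        (f := fun a => (b, a))).trans (hG.2 b').le
      exact_mod_cast this.trans (Nat.le_add_left _ _)

theorem IsSparse.submatrix {Q Q' R : Type*} {H : Matrix R Q' (ZMod 2)} {D : ℕ}
    (h : IsSparse H D) (e : Q ≃ Q') : IsSparse (H.submatrix id e) D := by
  refine ⟨fun c => ?_, fun q => h.2 (e q)⟩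
  rw [← e.injective.encard_image]
  refine (Set.encard_le_encard ?_).trans (h.1 c)
  rintro _ ⟨q, hq, rfl⟩
  exact hq

theorem isFlippable_product {Q : Type*} [Fintype Q] [DecidableEq Q] {G : A → B → Prop}
    {ΔA ΔB m : ℕ} {γA δA γB δB : ℝ}
    (hΔA : 1 ≤ ΔA) (hΔB : 1 ≤ ΔB) (hδA : δA < 1 / 6) (hδB : δB < 1 / 6)
    (hG : IsBiregular G ΔA ΔB) (hL : IsLeftExpanding G ΔA γA δA)
    (hR : IsRightExpanding G ΔB γB δB) (hmA : (m : ℝ) ≤ γA * Fintype.card A)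
    (hmB : (m : ℝ) ≤ γB * Fintype.card B) (e : Q ≃ (A × A) ⊕ (B × B)) :
    IsFlippable ((productHZ G).submatrix id e)
      (Submodule.span (ZMod 2) (Set.range ((productHX G).submatrix id e).row)) m (ΔA + ΔB) := by
  classical
  intro x hx hne hxm
  set y := x.map e.toEmbedding with hy
  have hycard : y.toLeft.card + y.toRight.card = x.card := by
    rw [Finset.card_toLeft_add_card_toRight, hy, Finset.card_map]
  have hred : ∀ c, 2 * checkDegree (fun b a => G a b) y.toRight y.toLeft c ≤ ΔA + ΔB := by
    intro c
    have h := hx.two_mul_card_filter_le c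
    rw [card_filter_submatrix, card_filter_submatrix, card_filter_productHX,
      card_filter_productHX, Finset.map_univ_equiv] at h
    have h1 : (Finset.univ : Finset ((A × A) ⊕ (B × B))).toLeft = Finset.univ := by ext; simp
    have h2 : (Finset.univ : Finset ((A × A) ⊕ (B × B))).toRight = Finset.univ := by ext; simp
    rwa [h1, h2, checkDegree_univ hG.swap] at h
  have hlr : y.toLeft.Nonempty ∨ y.toRight.Nonempty := by
    rw [← Finset.card_pos, ← Finset.card_pos]
    have := hne.card_pos
    omega
  obtain ⟨FA, FB, hF, hlt⟩ := exists_flip hΔA hΔB hδA hδB hG hL hR hlr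
    (le_trans (by exact_mod_cast (by omega : y.toLeft.card ≤ m)) hmA)
    (le_trans (by exact_mod_cast (by omega : y.toRight.card ≤ m)) hmB) hred
  refine ⟨(FA.disjSum FB).map e.symm.toEmbedding, by simpa using hF, ?_⟩
  rw [syndrome_symmDiff, syndrome_submatrix, syndrome_submatrix, Finset.map_map]
  have hid : e.symm.toEmbedding.trans e.toEmbedding = Function.Embedding.refl _ := by
    ext q
    simp
  rw [hid, Finset.map_refl, syndrome_productHZ, syndrome_productHZ, Finset.toLeft_disjSum,
    Finset.toRight_disjSum, ← Finset.coe_symmDiff, Set.ncard_coe_finset, Set.ncard_coe_finset]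
  set X := unsatisfied G y.toLeft y.toRight
  set F := unsatisfied G FA FB
  -- The new syndrome weight is |X| + |F| - 2|X ∩ F|, below |X| because more than half of F lies in
  -- X.
  have h2 : (X ∆ F).card = (X \ F).card + (F \ X).card :=
    Finset.card_union_of_disjoint disjoint_sdiff_sdiff
  have h3 := Finset.card_sdiff_add_card_inter X F
  have h4 := Finset.card_sdiff_add_card_inter F X
  rw [Finset.inter_comm] at h3
  omega

theorem IsBiregular.card_mul_eq {G : A → B → Prop} {ΔA ΔB : ℕ} (hG : IsBiregular G ΔA ΔB) :
    Fintype.card A * ΔA = Fintype.card B * ΔB := by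
  classical
  have h := Finset.sum_card_bipartiteAbove_eq_sum_card_bipartiteBelow
    (s := (Finset.univ : Finset A)) (t := (Finset.univ : Finset B)) fun a b => G a b
  simpa only [Finset.bipartiteAbove, Finset.bipartiteBelow, hG.1, hG.2, Finset.sum_const,
    Finset.card_univ, smul_eq_mul] using h

/-- Edge counting gives |B| ≤ ΔA |A|, so n = |A|² + |B|² is at most ((1 + ΔA)|A|)². It converts
expansion of sets of size γ|A| into a threshold of order √n. -/
theorem IsBiregular.sqrt_card_le {G : A → B → Prop} {ΔA ΔB : ℕ} (hG : IsBiregular G ΔA ΔB)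
    (hΔB : 1 ≤ ΔB) :
    √(Fintype.card ((A × A) ⊕ (B × B)) : ℝ) ≤ (1 + ΔA) * Fintype.card A := by
  have h : Fintype.card B ≤ Fintype.card A * ΔA := by
    rw [hG.card_mul_eq]
    exact Nat.le_mul_of_pos_right _ hΔB
  have h' : (Fintype.card B : ℝ) ≤ Fintype.card A * ΔA := by exact_mod_cast h
  rw [Real.sqrt_le_left (by positivity)]
  simp only [Fintype.card_sum, Fintype.card_prod, Nat.cast_add, Nat.cast_mul]
  have h2 := mul_self_le_mul_self (by positivity) h'
  have h3 : 0 ≤ (Fintype.card A : ℝ) * Fintype.card A * ΔA := by positivity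
  linarith

end Product

/-- The Union-Find decoder corrects small errors of every code equivalent to the hypergraph
product of an expander graph, once the number of qubits is large compared to the weight. -/
theorem unionFindCorrectsX_of_expanding {A B Q : Type*} [Fintype A] [Fintype B] [Fintype Q]
    {G : A → B → Prop} {ΔA ΔB κ : ℕ} {γA δA γB δB N : ℝ}
    (hΔA : 1 ≤ ΔA) (hΔB : 1 ≤ ΔB) (hδA : δA < 1 / 6) (hδB : δB < 1 / 6)
    (hG : IsBiregular G ΔA ΔB) (hL : IsLeftExpanding G ΔA γA δA)
    (hR : IsRightExpanding G ΔB γB δB) (hNA : N ≤ γA * Fintype.card A)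
    (hNB : N ≤ γB * Fintype.card B) (e : Q ≃ (A × A) ⊕ (B × B)) (C : CSSCode Q (A × B) (B × A))
    (hX : C.HX = (productHX G).submatrix id e) (hZ : C.HZ = (productHZ G).submatrix id e)
    (hκ : (1 - 1 / ((ΔA + ΔB : ℕ) : ℝ) ^ 2) ^ κ * (((ΔA + ΔB : ℕ) : ℝ) + 1) ^ 2 ≤ 1)
    (x : Finset Q)
    (hx : ((2 * (ΔA + ΔB) * (ΔA + ΔB + 1) ^ 4 * (1 + (ΔA + ΔB) ^ 2) : ℕ) : ℝ)
      * (x.card : ℝ) ^ (κ + 1) ≤ N) : C.UnionFindCorrectsX x := by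
  classical
  set D := ΔA + ΔB
  have hN : 0 ≤ N := le_trans (by positivity) hx
  have hm := Nat.floor_le hN
  have hflip := isFlippable_product hΔA hΔB hδA hδB hG hL hR (hm.trans hNA) (hm.trans hNB) e
  rw [← hX, ← hZ] at hflip
  have hsparse : IsSparse C.HZ D := hZ ▸ (isSparse_productHZ hG).submatrix e
  have hx' : 2 * D * (D + 1) ^ 4 * x.card ^ (κ + 1) * (1 + D ^ 2) ≤ ⌊N⌋₊ := by
    apply Nat.le_floor
    refine le_trans (le_of_eq ?_) hx
    push_cast
    ring
  exact C.unionFindCorrectsX_of_isSound (by omega) hsparse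
    (hflip.isSound (fun s hs => C.mulVec_eq_zero_of_mem_span hs) hsparse hx') hκ x le_rfl

end QExp

/-! ### Choice of the constants and conclusion. -/

theorem corollary2 (ΔA ΔB : ℕ) (hΔA : 1 ≤ ΔA) (hΔB : 1 ≤ ΔB)
    (γA δA γB δB : ℝ) (hγA : 0 < γA) (hγB : 0 < γB) (hδA : δA < 1 / 6) (hδB : δB < 1 / 6) :
    ∃ c β : ℝ, 0 < c ∧ 0 < β ∧
      ∀ (A B : Type*) [Fintype A] [Fintype B] (G : A → B → Prop),
        QExp.IsBiregular G ΔA ΔB →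
        QExp.IsLeftExpanding G ΔA γA δA →
        QExp.IsRightExpanding G ΔB γB δB →
        ∀ x : Finset ((A × A) ⊕ (B × B)),
          (x.card : ℝ) ≤ c * (Fintype.card ((A × A) ⊕ (B × B)) : ℝ) ^ β →
          (QExp.productCode G).UnionFindCorrectsX x ∧
            (QExp.productCode G).UnionFindCorrectsZ x := by
  set D := ΔA + ΔB with hD
  have hD1 : (1 : ℝ) ≤ D := by exact_mod_cast (by omega : 1 ≤ D)
  have hρ0 : 0 ≤ 1 - 1 / (D : ℝ) ^ 2 := by
    rw [sub_nonneg, div_le_one (by positivity)]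
    exact one_le_pow₀ hD1
  have hρ1 : 1 - 1 / (D : ℝ) ^ 2 < 1 := by
    have : 0 < 1 / (D : ℝ) ^ 2 := by positivity
    linarith
  obtain ⟨κ, hκ⟩ := exists_pow_lt_of_lt_one
    (show 0 < 1 / ((D : ℝ) + 1) ^ 2 by positivity) hρ1
  replace hκ : (1 - 1 / (D : ℝ) ^ 2) ^ κ * ((D : ℝ) + 1) ^ 2 ≤ 1 :=
    ((lt_div_iff₀ (by positivity)).mp hκ).le
  -- The factor 2D(D + 1)⁴ bounds error plus correction, and 1 + D² leaves room for the flips in the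
  -- soundness proof.
  set K : ℝ := ((2 * D * (D + 1) ^ 4 * (1 + D ^ 2) : ℕ) : ℝ) with hK
  have hKpos : 0 < K := by
    have : 0 < D := by omega
    rw [hK]
    positivity
  set c₀ := min (γA / (1 + ΔA)) (γB / (1 + ΔB)) with hc₀
  have hc₀pos : 0 < c₀ := lt_min (by positivity) (by positivity)
  -- The exponent β turns the (κ + 1)-st power of the weight into √n; capping the constant at 1
  -- keeps its (κ + 1)-st power below c₀ / K.
  refine ⟨min 1 (c₀ / K), 1 / (2 * ((κ + 1 : ℕ) : ℝ)), lt_min one_pos (by positivity),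
    by positivity, ?_⟩
  intro A B _ _ G hG hL hR x hx
  set n : ℝ := (Fintype.card ((A × A) ⊕ (B × B)) : ℝ) with hn
  have hn0 : 0 ≤ n := Nat.cast_nonneg _
  have hxn : K * (x.card : ℝ) ^ (κ + 1) ≤ c₀ * √n := by
    have hc1 : min 1 (c₀ / K) ^ (κ + 1) ≤ c₀ / K :=
      (pow_le_of_le_one (by positivity) (min_le_left _ _) (by omega)).trans (min_le_right _ _)
    have hroot : (n ^ (1 / (2 * ((κ + 1 : ℕ) : ℝ)))) ^ (κ + 1) = √n := by
      rw [← Real.rpow_natCast, ← Real.rpow_mul hn0, Real.sqrt_eq_rpow]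
      congr 1
      field_simp
    calc K * (x.card : ℝ) ^ (κ + 1)
        ≤ K * (min 1 (c₀ / K) * n ^ (1 / (2 * ((κ + 1 : ℕ) : ℝ)))) ^ (κ + 1) := by gcongr
      _ = K * (min 1 (c₀ / K) ^ (κ + 1) * √n) := by rw [mul_pow, hroot]
      _ ≤ K * (c₀ / K * √n) := by gcongr
      _ = c₀ * √n := by field_simp
  have hcommute : Fintype.card ((B × B) ⊕ (A × A)) = Fintype.card ((A × A) ⊕ (B × B)) :=
    Fintype.card_congr (Equiv.sumComm _ _)
  have hNA : c₀ * √n ≤ γA * Fintype.card A := by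
    have h := hG.sqrt_card_le hΔB
    calc c₀ * √n ≤ γA / (1 + ΔA) * ((1 + ΔA) * Fintype.card A) := by
          gcongr
          exact min_le_left _ _
      _ = γA * Fintype.card A := by field_simp
  have hNB : c₀ * √n ≤ γB * Fintype.card B := by
    have h := hG.swap.sqrt_card_le hΔA
    rw [hcommute] at h
    calc c₀ * √n ≤ γB / (1 + ΔB) * ((1 + ΔB) * Fintype.card B) := by
          gcongr
          exact min_le_right _ _
      _ = γB * Fintype.card B := by field_simp
  constructor
  · exact QExp.unionFindCorrectsX_of_expanding hΔA hΔB hδA hδB hG hL hR hNA hNB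
      (Equiv.refl _) (QExp.productCode G) rfl rfl hκ x hxn
  · refine QExp.unionFindCorrectsX_of_expanding (κ := κ) hΔB hΔA hδB hδA hG.swap hR hL hNB hNA
      (Equiv.sumComm _ _) (QExp.productCode G).swap (QExp.productHZ_eq_submatrix G)
      (QExp.productHX_eq_submatrix G) ?_ x ?_
    · rwa [add_comm ΔB ΔA]
    · rwa [add_comm ΔB ΔA]
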